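/- Let $\omega$ be the standard symplectic form on $\mathbb R^{2n+2}$, let $0\neq A\in\mathfrak{sp}(n+1,\mathbb R)$ (that is, $\omega(Ax,y)=-\omega(x,Ay)$), let $0\neq\mu_0\in\mathbb R$, and let $H(x)=\omega(x,Ax)$. Assume that the quadric $\Sigma=\{x\in\mathbb R^{2n+2} : H(x)=\mu_0\}$ is non-empty; its tangent space at $x$ is $\{v:\omega(v,Ax)=0\}$. Let $\psi_t=\exp(-2tA)$ be the flow of the Hamiltonian vector field $X_H(x)=-2Ax$, let $M=\Sigma/\psi_t$ be the orbit space with the quotient topology and $\pi:\Sigma\to M$ the projection. Assume that $M$ is a (Hausdorff) smooth manifold of dimension $2n$ for which $\pi$ is a smooth submersion. For $x\in\Sigma$ let $H_x=\{v : \omega(v,x)=\omega(v,Ax)=0\}$; then $d\pi_x$ maps $H_x$ isomorphically onto $T_{\pi(x)}M$, and a vector field $Y$ on $M$ has a unique lift $\bar Y$ with $\bar Y_x\in H_x$ and $d\pi_x\bar Y_x=Y_{\pi(x)}$ for all $x\in\Sigma$. For vector fields $V,W$ on $\Sigma$ put $(\nabla_VW)_x=(D_VW)_x+\frac1{\mu_0}\,\omega(W,AV)\,x$,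 where $D$ is the flat derivative of $\mathbb R^{2n+2}$. The reduced connection $\nabla^r$ on $M$ is defined, for smooth vector fields $Y,Z$ on $M$, by $$\overline{\nabla^r_YZ}=\nabla_{\bar Y}\bar Z+\frac1{\mu_0}\,\omega(\bar Y,\bar Z)\,Ax .$$ Theorem. The formula above does define a smooth vector field $\nabla^r_YZ$ on $M$ for all smooth vector fields $Y,Z$ on $M$, and the reduced connection $\nabla^r$ is locally symmetric, i.e. its curvature tensor $R$ (with $R(Y,Z)T=\nabla^r_Y\nabla^r_ZT-\nabla^r_Z\nabla^r_YT-\nabla^r_{[Y,Z]}T$) satisfies $\nabla^r R=0$, if and only if $A^2=\lambda\,\mathrm{Id}$ for some $\lambda\in\mathbb R$. -/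

import Mathlib

open scoped Manifold ContDiff Matrix

noncomputable section

namespace SymplecticReduction

/-- The standard symplectic vector space `ℝ^{2n+2}`, with coordinates `(p, q)`. -/
abbrev Vec (n : ℕ) : Type := Fin (n + 1) ⊕ Fin (n + 1) → ℝ

/-- Real square matrices of size `2n+2`, acting on `Vec n`. -/
abbrev Mat (n : ℕ) : Type := Matrix (Fin (n + 1) ⊕ Fin (n + 1)) (Fin (n + 1) ⊕ Fin (n + 1)) ℝ

/-- The standard symplectic form on `ℝ^{2n+2}`. -/
def omega {n : ℕ} (x y : Vec n) : ℝ :=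
  ∑ i, (x (Sum.inl i) * y (Sum.inr i) - x (Sum.inr i) * y (Sum.inl i))

lemma omega_eq {n : ℕ} (x y : Vec n) :
    omega x y = -(x ⬝ᵥ Matrix.J (Fin (n + 1)) ℝ *ᵥ y) := by
  simp only [omega, Finset.sum_sub_distrib]
  simp [Matrix.J, Matrix.fromBlocks_mulVec, dotProduct, Fintype.sum_sum_type, Matrix.neg_mulVec,
    sub_eq_add_neg, add_comm]

/-- Membership in Mathlib's symplectic Lie algebra is skewness with respect to `omega`. -/
lemma mem_sp_iff {n : ℕ} (A : Mat n) :
    A ∈ LieAlgebra.Symplectic.sp (Fin (n + 1)) ℝ ↔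
      ∀ x y : Vec n, omega (A *ᵥ x) y = -omega x (A *ᵥ y) := by
  rw [LieAlgebra.Symplectic.sp, mem_skewAdjointMatricesLieSubalgebra,
    mem_skewAdjointMatricesSubmodule, Matrix.IsSkewAdjoint, Matrix.IsAdjointPair]
  have key : (∀ x y : Vec n, omega (A *ᵥ x) y = -omega x (A *ᵥ y)) ↔
      ∀ x y : Vec n, x ⬝ᵥ (Aᵀ * Matrix.J (Fin (n + 1)) ℝ) *ᵥ y
        = x ⬝ᵥ (Matrix.J (Fin (n + 1)) ℝ * -A) *ᵥ y := by
    refine forall_congr' fun x => forall_congr' fun y => ?_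
    rw [omega_eq, omega_eq, ← Matrix.mulVec_mulVec, ← Matrix.mulVec_mulVec,
      Matrix.dotProduct_mulVec x Aᵀ, Matrix.vecMul_transpose, Matrix.neg_mulVec,
      Matrix.mulVec_neg, dotProduct_neg]
    constructor <;> intro h <;> linarith
  rw [key]
  refine ⟨fun h x y => by rw [h], fun h => ?_⟩
  ext i j
  simpa [Matrix.mulVec_single_one] using h (Pi.single i 1) (Pi.single j 1)

/-- The quadratic Hamiltonian `H(x) = ω(x, Ax)`. -/
def hamiltonian {n : ℕ} (A : Mat n) (x : Vec n) : ℝ := omega x (A *ᵥ x)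

/-- The quadric `Σ = {x | H(x) = μ}`. -/
def quadric {n : ℕ} (A : Mat n) (μ : ℝ) : Set (Vec n) := {x | hamiltonian A x = μ}

/-- The flow `ψ_t` of the (linear) Hamiltonian vector field `X_H(x) = -2Ax`. -/
def flow {n : ℕ} (A : Mat n) (t : ℝ) (x : Vec n) : Vec n := NormedSpace.exp ((-2 * t) • A) *ᵥ x

lemma flow_zero {n : ℕ} (A : Mat n) (x : Vec n) : flow A 0 x = x := by
  simp [flow, NormedSpace.exp_zero]

lemma flow_add {n : ℕ} (A : Mat n) (s t : ℝ) (x : Vec n) :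
    flow A (s + t) x = flow A s (flow A t x) := by
  rw [flow, flow, flow, Matrix.mulVec_mulVec, ← Matrix.exp_add_of_commute, ← add_smul, mul_add]
  exact ((Commute.refl A).smul_left _).smul_right _

/-- Two points of the quadric are equivalent if they lie on the same orbit of `ψ_t`. -/
def orbitSetoid {n : ℕ} (A : Mat n) (μ : ℝ) : Setoid (quadric A μ) where
  r x y := ∃ t : ℝ, flow A t (x : Vec n) = y
  iseqv :=
    { refl := fun x => ⟨0, flow_zero A x⟩
      symm := by
        rintro x y ⟨t, h⟩
        exact ⟨-t, by rw [← h, ← flow_add, neg_add_cancel, flow_zero]⟩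
      trans := by
        rintro x y z ⟨s, hs⟩ ⟨t, ht⟩
        exact ⟨t + s, by rw [flow_add, hs, ht]⟩ }

/-- The orbit space `M = Σ / ψ_t`, with the quotient topology. -/
abbrev ReducedSpace {n : ℕ} (A : Mat n) (μ : ℝ) : Type := Quotient (orbitSetoid A μ)

open Classical in
/-- The canonical projection `π : Σ → M`, extended by an arbitrary constant outside `Σ`; only its
restriction to `Σ` is ever used. -/
def proj {n : ℕ} (A : Mat n) (μ : ℝ) [Nonempty (quadric A μ)] (x : Vec n) : ReducedSpace A μ :=
  if h : x ∈ quadric A μ then Quotient.mk (orbitSetoid A μ) ⟨x, h⟩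
  else Quotient.mk (orbitSetoid A μ) (Classical.arbitrary _)

/-- The tangent space `T_xΣ = (Ax)^⊥` of the quadric, the kernel of `dH_x = 2 ω(·, Ax)`. -/
def tangentQuadric {n : ℕ} (A : Mat n) (x : Vec n) : Set (Vec n) := {v | omega v (A *ᵥ x) = 0}

/-- The horizontal space `H_x = (span(x, Ax))^⊥`. -/
def horizontal {n : ℕ} (A : Mat n) (x : Vec n) : Set (Vec n) :=
  {v | omega v x = 0 ∧ omega v (A *ᵥ x) = 0}

section Reduced

variable {n : ℕ} (A : Mat n) (μ : ℝ) [Nonempty (quadric A μ)]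
  [ChartedSpace (EuclideanSpace ℝ (Fin (2 * n))) (ReducedSpace A μ)]

/-- The differential of `π : Σ → M` at a point `x` of `Σ`: the derivative of `π` along the subset
`Σ`. Only its values on vectors tangent to `Σ` are meaningful, and these do not depend on choices,
because the tangent vectors of the submanifold `Σ` lie in its tangent cone. -/
def dproj (x : Vec n) : Vec n →L[ℝ] TangentSpace (𝓡 (2 * n)) (proj A μ x) :=
  mfderivWithin 𝓘(ℝ, Vec n) (𝓡 (2 * n)) (proj A μ) (quadric A μ) x

/-- `π : Σ → M` is a smooth submersion. (Smoothness on the embedded submanifold `Σ` is smoothness on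
the subset `Σ` of the ambient vector space.) -/
def IsSmoothSubmersion : Prop :=
  ContMDiffOn 𝓘(ℝ, Vec n) (𝓡 (2 * n)) ∞ (proj A μ) (quadric A μ) ∧
    ∀ x ∈ quadric A μ, ∀ w : TangentSpace (𝓡 (2 * n)) (proj A μ x),
      ∃ v ∈ tangentQuadric A x, dproj A μ x v = w

/-- Vector fields on `M` (no regularity). -/
abbrev VField : Type := (y : ReducedSpace A μ) → TangentSpace (𝓡 (2 * n)) y

variable {A μ}

/-- `Y` is a smooth vector field on `M`. -/
def IsSmooth [IsManifold (𝓡 (2 * n)) ∞ (ReducedSpace A μ)] (Y : VField A μ) : Prop :=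
  ContMDiff (𝓡 (2 * n)) (𝓡 (2 * n)).tangent ∞
    (fun y => (⟨y, Y y⟩ : TangentBundle (𝓡 (2 * n)) (ReducedSpace A μ)))

/-- The horizontal lift `Ȳ` of a vector field `Y` on `M`: at `x ∈ Σ` it is the vector of `H_x` which
`dπ_x` maps to `Y_{π(x)}` (it is unique when `π` is a smooth submersion). -/
def lift (Y : VField A μ) (x : Vec n) : Vec n :=
  Classical.epsilon fun v => v ∈ horizontal A x ∧ dproj A μ x v = Y (proj A μ x)

/-- The flat derivative `D_V W` on the quadric: the derivative along `Σ` of the vector-valued function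
`W`, in the direction `V`, at `x ∈ Σ`. -/
def flatDeriv (A : Mat n) (μ : ℝ) (V W : Vec n → Vec n) (x : Vec n) : Vec n :=
  fderivWithin ℝ W (quadric A μ) x (V x)

/-- The connection `(∇_V W)_x = (D_V W)_x + μ⁻¹ ω(W, AV) x` on the quadric. -/
def quadricConn (A : Mat n) (μ : ℝ) (V W : Vec n → Vec n) (x : Vec n) : Vec n :=
  flatDeriv A μ V W x + (1 / μ * omega (W x) (A *ᵥ V x)) • x

/-- `W` is the vector field on `M` whose lift is `∇_Ȳ Z̄ + μ⁻¹ ω(Ȳ, Z̄) Ax`. -/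
def IsReducedDeriv (Y Z W : VField A μ) : Prop :=
  ∀ x ∈ quadric A μ, lift W x =
    quadricConn A μ (lift Y) (lift Z) x + (1 / μ * omega (lift Y x) (lift Z x)) • (A *ᵥ x)

variable (A μ) in
/-- The reduced connection `∇^r` on `M`: `∇^r_Y Z` is the vector field on `M` whose lift is
`∇_Ȳ Z̄ + μ⁻¹ ω(Ȳ, Z̄) Ax`. -/
def reducedConn (Y Z : VField A μ) : VField A μ :=
  Classical.epsilon fun W => IsReducedDeriv Y Z W

/-- The curvature `R(Y, Z)T = ∇_Y ∇_Z T - ∇_Z ∇_Y T - ∇_{[Y, Z]} T`. -/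
def curvature (nabla : VField A μ → VField A μ → VField A μ) (Y Z T : VField A μ) : VField A μ :=
  nabla Y (nabla Z T) - nabla Z (nabla Y T) -
    nabla (VectorField.mlieBracket (𝓡 (2 * n)) Y Z) T

/-- The covariant derivative `(∇_X R)(Y, Z)T` of the curvature. -/
def curvatureDeriv (nabla : VField A μ → VField A μ → VField A μ) (X Y Z T : VField A μ) :
    VField A μ :=
  nabla X (curvature nabla Y Z T) - curvature nabla (nabla X Y) Z T
    - curvature nabla Y (nabla X Z) T - curvature nabla Y Z (nabla X T)

/-- The connection is locally symmetric: `∇R = 0`. -/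
def IsLocallySymmetric [IsManifold (𝓡 (2 * n)) ∞ (ReducedSpace A μ)]
    (nabla : VField A μ → VField A μ → VField A μ) : Prop :=
  ∀ X Y Z T : VField A μ, IsSmooth X → IsSmooth Y → IsSmooth Z → IsSmooth T →
    curvatureDeriv nabla X Y Z T = 0

end Reduced

end SymplecticReduction

end

/-! Write u for the horizontal part of A²x (`redVec`) and Â for the endomorphism of H_x induced by A
(`redEnd`). The lift of the reduced derivative is the flat derivative, made horizontal by multiples
of x and Ax (`liftConn`). Commuting two such derivatives modulo the plane spanned by x and Ax
expresses the curvature through ω and Â alone (`exists_liftConn_curvature`). The form ω is parallel,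
because x and Ax are orthogonal to H_x, and (∇_X Â)T = μ⁻¹(ω(T,u)X + ω(T,X)u) by `liftConn_redEnd`.
Hence ∇R is the same expression with Â replaced by ∇Â (`liftConn_liftCurv`).

If A² is scalar then u = 0, so ∇R = 0. Conversely ω(T, (∇_u R)(u,T)T) = 8μ⁻² ω(T,u)³
(`bilin_redVec_eq_zero`), so ∇R = 0 makes u orthogonal to H_x, where ω is nondegenerate, and u = 0.
Every point of Σ is then an eigenvector of A², hence so is every point of an open cone, and A² is a
homothety (`exists_eq_smul_of_isOpen`).

The analysis rests on the radial retraction of that cone onto Σ, which extends π and all lifts to an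
open set and turns derivatives along Σ into ordinary ones. A lift solves an invertible linear system
given by dπ, ω(·,x) and ω(·,Ax), hence is smooth. The defining formula descends to M because it is
horizontal and equivariant under the flow, and the result is smooth because π has smooth local
sections (`isSmooth_of_dcone`). -/

open scoped Topology

namespace SymplecticReduction

/-! ### Pointwise calculus of the lifted connection and its curvature. -/

section Algebra

variable {V : Type*} [NormedAddCommGroup V] [NormedSpace ℝ V]
  (σ : V →L[ℝ] V →L[ℝ] ℝ) (a : V →L[ℝ] V) (μ : ℝ)

/-- The lift `D_X f + μ⁻¹ σ(f, aX) x + μ⁻¹ σ(X, f) ax` of the reduced derivative at `x`. -/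
noncomputable def liftConn (X : V) (f : V → V) (x : V) : V :=
  fderiv ℝ f x X + (1 / μ * σ (f x) (a X)) • x + (1 / μ * σ X (f x)) • a x

/-- The endomorphism induced by `a` on the horizontal space at `x`. -/
noncomputable def redEnd (x v : V) : V := a v + (1 / μ * σ v (a (a x))) • x

/-- The horizontal part of `a² x`. -/
noncomputable def redVec (x : V) : V := a (a x) - (1 / μ * σ (a (a x)) (a x)) • x

/-- The lift of the curvature of the reduced connection. -/
noncomputable def liftCurv (x Y Z T : V) : V :=
  (1 / μ) • (-(2 * σ Y Z) • redEnd σ a μ x T + σ T (a Z) • Y - σ T (a Y) • Z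
    + σ Z T • redEnd σ a μ x Y - σ Y T • redEnd σ a μ x Z)

/-- The lift of the covariant derivative of `redEnd`. -/
noncomputable def redEndDeriv (x X T : V) : V :=
  (1 / μ) • (σ T (redVec σ a μ x) • X + σ T X • redVec σ a μ x)

/-- The lift of the covariant derivative of the curvature of the reduced connection. -/
noncomputable def liftCurvDeriv (x X Y Z T : V) : V :=
  (1 / μ) • (-(2 * σ Y Z) • redEndDeriv σ a μ x X T + σ T (redEndDeriv σ a μ x X Z) • Y
    - σ T (redEndDeriv σ a μ x X Y) • Z
    + σ Z T • redEndDeriv σ a μ x X Y - σ Y T • redEndDeriv σ a μ x X Z)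

variable {σ a μ}

/-- Since σ(x, ax) = μ ≠ 0, the plane spanned by x and ax meets its orthogonal only in 0. Curvature
may therefore be computed modulo this plane. -/
lemma eq_of_horizontal_of_sub_eq (hσ : ∀ v, σ v v = 0) (hμ : μ ≠ 0) {x v w : V}
    (hx : σ x (a x) = μ) (hv : σ v x = 0 ∧ σ v (a x) = 0) (hw : σ w x = 0 ∧ σ w (a x) = 0)
    {α β : ℝ} (h : v = w + α • x + β • a x) : v = w := by
  have h1 := hv.1
  have h2 := hv.2
  have hanti : σ (a x) x = -μ := by
    have := hσ (x + a x)
    simp only [map_add, add_apply, hσ, hx] at this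
    linarith
  rw [h] at h1 h2
  simp only [map_add, map_smul, add_apply, smul_apply,
    hσ, hx, hw.1, hw.2, hanti, smul_eq_mul] at h1 h2
  have hα : α = 0 := by
    have : α * μ = 0 := by linarith
    exact (mul_eq_zero.1 this).resolve_right hμ
  have hβ : β = 0 := by
    have : β * μ = 0 := by linarith
    exact (mul_eq_zero.1 this).resolve_right hμ
  simp [h, hα, hβ]

lemma fderiv_bilin {f g : V → V} {x : V} (hf : DifferentiableAt ℝ f x)
    (hg : DifferentiableAt ℝ g x) (X : V) :
    fderiv ℝ (fun y => σ (f y) (g y)) x X = σ (fderiv ℝ f x X) (g x) + σ (f x) (fderiv ℝ g x X) := by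
  have := (σ.hasFDerivAt_of_bilinear hf.hasFDerivAt hg.hasFDerivAt).fderiv
  rw [this]
  simp [add_comm]

lemma differentiableAt_bilin {f g : V → V} {x : V} (hf : DifferentiableAt ℝ f x)
    (hg : DifferentiableAt ℝ g x) : DifferentiableAt ℝ (fun y => σ (f y) (g y)) x :=
  (σ.hasFDerivAt_of_bilinear hf.hasFDerivAt hg.hasFDerivAt).differentiableAt

/-- The symplectic form is parallel: the corrections along x and ax pair to zero with horizontal
vectors. -/
lemma fderiv_bilin_eq_liftConn {f g : V → V} {x : V} (hσ : ∀ v w, σ v w = -σ w v)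
    (hf : DifferentiableAt ℝ f x) (hg : DifferentiableAt ℝ g x)
    (hfx : σ (f x) x = 0 ∧ σ (f x) (a x) = 0) (hgx : σ (g x) x = 0 ∧ σ (g x) (a x) = 0) (X : V) :
    fderiv ℝ (fun y => σ (f y) (g y)) x X
      = σ (liftConn σ a μ X f x) (g x) + σ (f x) (liftConn σ a μ X g x) := by
  rw [fderiv_bilin hf hg]
  simp [liftConn, hfx.1, hfx.2, hσ x (g x), hσ (a x) (g x), hgx.1, hgx.2]

lemma liftConn_add {f g : V → V} {x : V} (hf : DifferentiableAt ℝ f x)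
    (hg : DifferentiableAt ℝ g x) (X : V) :
    liftConn σ a μ X (fun y => f y + g y) x = liftConn σ a μ X f x + liftConn σ a μ X g x := by
  simp only [liftConn]
  rw [fderiv_fun_add hf hg]
  simp only [map_add, add_apply, mul_add, add_smul]
  abel

lemma liftConn_sub {f g : V → V} {x : V} (hf : DifferentiableAt ℝ f x)
    (hg : DifferentiableAt ℝ g x) (X : V) :
    liftConn σ a μ X (fun y => f y - g y) x = liftConn σ a μ X f x - liftConn σ a μ X g x := by
  simp only [liftConn]
  rw [fderiv_fun_sub hf hg]
  simp only [map_sub, sub_apply, mul_sub, sub_smul]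
  abel

lemma liftConn_smul {φ : V → ℝ} {f : V → V} {x : V} (hφ : DifferentiableAt ℝ φ x)
    (hf : DifferentiableAt ℝ f x) (X : V) :
    liftConn σ a μ X (fun y => φ y • f y) x = fderiv ℝ φ x X • f x + φ x • liftConn σ a μ X f x := by
  simp only [liftConn]
  rw [fderiv_fun_smul hφ hf]
  simp only [map_smul, add_apply, smul_apply,
    ContinuousLinearMap.smulRight_apply, smul_eq_mul]
  module

lemma differentiableAt_redEnd {f : V → V} {x : V} (hf : DifferentiableAt ℝ f x) :
    DifferentiableAt ℝ (fun y => redEnd σ a μ y (f y)) x := by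
  unfold redEnd
  have h : DifferentiableAt ℝ (fun y => σ (f y) (a (a y))) x :=
    differentiableAt_bilin hf (by fun_prop)
  fun_prop

/-- Two terms fail to commute. Differentiating the factor x in `redEnd` produces a multiple of X,
and applying `redEnd` to the correction along ax produces a multiple of the horizontal part of a²x.
-/
lemma liftConn_redEnd (hσ : ∀ v w, σ v w = -σ w v) (ha : ∀ v w, σ (a v) w = -σ v (a w))
    {f : V → V} {x X : V} (hf : DifferentiableAt ℝ f x)
    (hfx : σ (f x) x = 0 ∧ σ (f x) (a x) = 0) (hX : σ X x = 0 ∧ σ X (a x) = 0) :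
    liftConn σ a μ X (fun y => redEnd σ a μ y (f y)) x
      = redEnd σ a μ x (liftConn σ a μ X f x) + redEndDeriv σ a μ x X (f x) := by
  have h : DifferentiableAt ℝ (fun y => σ (f y) (a (a y))) x :=
    differentiableAt_bilin hf (by fun_prop)
  have h1 : fderiv ℝ (fun y => redEnd σ a μ y (f y)) x X = a (fderiv ℝ f x X)
      + (1 / μ * (σ (fderiv ℝ f x X) (a (a x)) + σ (f x) (a (a X)))) • x
      + (1 / μ * σ (f x) (a (a x))) • X := by
    unfold redEnd
    have h2 : fderiv ℝ (fun y => a (f y)) x X = a (fderiv ℝ f x X) := by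
      have := (a.hasFDerivAt.comp x hf.hasFDerivAt).fderiv
      rw [Function.comp_def] at this
      rw [this]; rfl
    have h3 : fderiv ℝ (fun y => a (a y)) x X = a (a X) := by
      have := (a.hasFDerivAt.comp x (a.hasFDerivAt (x := x))).fderiv
      rw [Function.comp_def] at this
      rw [this]; rfl
    have h4 : DifferentiableAt ℝ (fun y => a (f y)) x := by fun_prop
    rw [fderiv_fun_add h4 (by fun_prop), add_apply, h2,
      fderiv_fun_smul (h.const_mul _) differentiableAt_fun_id, fderiv_const_mul h]
    simp only [add_apply, smul_apply,
      ContinuousLinearMap.smulRight_apply, fderiv_bilin hf (show DifferentiableAt ℝ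
      (fun y => a (a y)) x by fun_prop), h3, fderiv_fun_id, ContinuousLinearMap.id_apply,
      smul_eq_mul]
    module
  have e1 : σ (a (f x)) (a X) = -σ (f x) (a (a X)) := ha _ _
  have e2 : σ x (a X) = 0 := by
    have h1 := ha x X
    have h2 := hσ (a x) X
    have h3 := hX.2
    linarith
  have e3 : σ X (a (f x)) = σ (f x) (a X) := by
    have h1 := ha X (f x)
    have h2 := hσ (a X) (f x)
    linarith
  have e4 : σ x (a (a x)) = 0 := by
    have h1 := ha x (a x)
    have h2 := hσ (a x) (a x)
    linarith
  have e5 : σ (a x) (a (a x)) = -σ (a (a x)) (a x) := hσ _ _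
  have e6 : σ X (f x) = -σ (f x) X := hσ _ _
  simp only [liftConn, h1, redEndDeriv, redVec]
  simp only [redEnd, map_add, map_sub, map_smul, add_apply,
    smul_apply, smul_eq_mul, e1, e2, e3, e4, e5, e6, hfx.1, hX.1]
  module

/-- The curvature of the reduced connection, modulo the span of `x` and `a x`. -/
lemma exists_liftConn_curvature (hσ : ∀ v w, σ v w = -σ w v) (ha : ∀ v w, σ (a v) w = -σ v (a w))
    {Y Z T : V → V} {x : V} (hY : ContDiffAt ℝ ∞ Y x) (hZ : ContDiffAt ℝ ∞ Z x)
    (hT : ContDiffAt ℝ ∞ T x) (hTx : fderiv ℝ T x (a x) = a (T x)) :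
    ∃ α β : ℝ, liftConn σ a μ (Y x) (fun y => liftConn σ a μ (Z y) T y) x
        - liftConn σ a μ (Z x) (fun y => liftConn σ a μ (Y y) T y) x
        - liftConn σ a μ (liftConn σ a μ (Y x) Z x - liftConn σ a μ (Z x) Y x) T x
      = liftCurv σ a μ x (Y x) (Z x) (T x) + α • x + β • a x := by
  -- Outside the span of x and ax, the corrections contribute only when the derivative hits the
  -- vectors x and ax themselves.
  have key : ∀ {Y Z : V → V}, ContDiffAt ℝ ∞ Y x → ContDiffAt ℝ ∞ Z x → ∃ α β : ℝ,
      liftConn σ a μ (Y x) (fun y => liftConn σ a μ (Z y) T y) x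
        = fderiv ℝ (fderiv ℝ T) x (Y x) (Z x) + fderiv ℝ T x (fderiv ℝ Z x (Y x))
          + (1 / μ * σ (T x) (a (Z x))) • Y x + (1 / μ * σ (Z x) (T x)) • a (Y x)
          + α • x + β • a x := by
    intro Y Z hY hZ
    have dZ : DifferentiableAt ℝ Z x := hZ.differentiableAt (by simp)
    have dT : DifferentiableAt ℝ T x := hT.differentiableAt (by simp)
    have dT' : DifferentiableAt ℝ (fderiv ℝ T) x :=
      (hT.fderiv_right (m := ∞) (by simp)).differentiableAt (by simp)
    have d1 : DifferentiableAt ℝ (fun y => fderiv ℝ T y (Z y)) x := dT'.clm_apply dZ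
    have d2 : DifferentiableAt ℝ (fun y => σ (T y) (a (Z y))) x :=
      differentiableAt_bilin dT (by fun_prop)
    have d3 : DifferentiableAt ℝ (fun y => σ (Z y) (T y)) x := differentiableAt_bilin dZ dT
    have h1 : fderiv ℝ (fun y => fderiv ℝ T y (Z y)) x (Y x)
        = fderiv ℝ (fderiv ℝ T) x (Y x) (Z x) + fderiv ℝ T x (fderiv ℝ Z x (Y x)) := by
      rw [fderiv_clm_apply dT' dZ]
      simp [add_comm]
    have h2 : fderiv ℝ (fun y => liftConn σ a μ (Z y) T y) x (Y x)
        = fderiv ℝ (fun y => fderiv ℝ T y (Z y)) x (Y x)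
          + ((1 / μ * fderiv ℝ (fun y => σ (T y) (a (Z y))) x (Y x)) • x
            + (1 / μ * σ (T x) (a (Z x))) • Y x)
          + ((1 / μ * fderiv ℝ (fun y => σ (Z y) (T y)) x (Y x)) • a x
            + (1 / μ * σ (Z x) (T x)) • a (Y x)) := by
      unfold liftConn
      have d4 : DifferentiableAt ℝ (fun y => (1 / μ * σ (T y) (a (Z y))) • y) x := by fun_prop
      have d5 : DifferentiableAt ℝ (fun y => (1 / μ * σ (Z y) (T y)) • a y) x := by fun_prop
      rw [fderiv_fun_add (d1.fun_add d4) d5, fderiv_fun_add d1 d4,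
        fderiv_fun_smul (d2.const_mul _) differentiableAt_fun_id, fderiv_const_mul d2,
        fderiv_fun_smul (d3.const_mul _) a.differentiableAt, fderiv_const_mul d3]
      simp only [add_apply, smul_apply,
        ContinuousLinearMap.smulRight_apply, ContinuousLinearMap.fderiv, fderiv_fun_id,
        ContinuousLinearMap.id_apply, smul_eq_mul]
      module
    refine ⟨1 / μ * fderiv ℝ (fun y => σ (T y) (a (Z y))) x (Y x)
        + 1 / μ * σ (liftConn σ a μ (Z x) T x) (a (Y x)),
      1 / μ * fderiv ℝ (fun y => σ (Z y) (T y)) x (Y x)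
        + 1 / μ * σ (Y x) (liftConn σ a μ (Z x) T x), ?_⟩
    conv_lhs => rw [liftConn, h2, h1]
    module
  obtain ⟨α₁, β₁, h₁⟩ := key hY hZ
  obtain ⟨α₂, β₂, h₂⟩ := key hZ hY
  have hsymm : fderiv ℝ (fderiv ℝ T) x (Y x) (Z x) = fderiv ℝ (fderiv ℝ T) x (Z x) (Y x) :=
    hT.isSymmSndFDerivAt (by simp; exact WithTop.coe_le_coe.2 (le_top : (2 : ℕ∞) ≤ ⊤)) _ _
  have e1 : σ (Y x) (a (Z x)) = σ (Z x) (a (Y x)) := by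
    have h1 := ha (Y x) (Z x)
    have h2 := hσ (a (Y x)) (Z x)
    linarith
  have e2 : σ (Z x) (Y x) = -σ (Y x) (Z x) := hσ _ _
  set W := liftConn σ a μ (Y x) Z x - liftConn σ a μ (Z x) Y x with hW
  -- W lifts the bracket. As σ(Y, aZ) is symmetric, the corrections along x cancel, while those
  -- along ax add up; through `hTx` this vertical part produces the term -2σ(Y, Z) aT of the
  -- curvature.
  have hW' : W = fderiv ℝ Z x (Y x) - fderiv ℝ Y x (Z x) + (2 / μ * σ (Y x) (Z x)) • a x := by
    rw [hW]
    simp only [liftConn, e1, e2]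
    module
  have h₃ : fderiv ℝ T x W = fderiv ℝ T x (fderiv ℝ Z x (Y x)) - fderiv ℝ T x (fderiv ℝ Y x (Z x))
      + (2 / μ * σ (Y x) (Z x)) • a (T x) := by
    rw [hW', map_add, map_sub, map_smul, hTx]
  -- The long bracket in the coefficient of x compensates for `liftCurv` containing `redEnd` where
  -- the computation yields a.
  refine ⟨α₁ - α₂ - 1 / μ * σ (T x) (a W) - (1 / μ) * (-(2 * σ (Y x) (Z x))
      * (1 / μ * σ (T x) (a (a x))) + σ (Z x) (T x) * (1 / μ * σ (Y x) (a (a x)))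
      - σ (Y x) (T x) * (1 / μ * σ (Z x) (a (a x)))), β₁ - β₂ - 1 / μ * σ W (T x), ?_⟩
  rw [h₁, h₂, liftConn, h₃, hsymm]
  simp only [liftCurv, redEnd]
  module

lemma differentiableAt_liftCurv {Y Z T : V → V} {x : V} (hY : DifferentiableAt ℝ Y x)
    (hZ : DifferentiableAt ℝ Z x) (hT : DifferentiableAt ℝ T x) :
    DifferentiableAt ℝ (fun y => liftCurv σ a μ y (Y y) (Z y) (T y)) x := by
  unfold liftCurv
  have h1 := differentiableAt_bilin (σ := σ) hY hZ
  have h2 := differentiableAt_bilin (σ := σ) hZ hT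
  have h3 := differentiableAt_bilin (σ := σ) hY hT
  have h4 : DifferentiableAt ℝ (fun y => σ (T y) (a (Z y))) x :=
    differentiableAt_bilin hT (by fun_prop)
  have h5 : DifferentiableAt ℝ (fun y => σ (T y) (a (Y y))) x :=
    differentiableAt_bilin hT (by fun_prop)
  have h6 := differentiableAt_redEnd (σ := σ) (a := a) (μ := μ) hY
  have h7 := differentiableAt_redEnd (σ := σ) (a := a) (μ := μ) hZ
  have h8 := differentiableAt_redEnd (σ := σ) (a := a) (μ := μ) hT
  fun_prop

/-- On horizontal vectors σ(T, aZ) equals σ(T, ÂZ). Since σ is parallel, the only new term is the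
derivative of Â. -/
lemma fderiv_bilin_map_eq (hσ : ∀ v w, σ v w = -σ w v) (ha : ∀ v w, σ (a v) w = -σ v (a w))
    {Z T : V → V} {x X : V} (hZ : DifferentiableAt ℝ Z x) (hT : DifferentiableAt ℝ T x)
    (hZx : σ (Z x) x = 0 ∧ σ (Z x) (a x) = 0) (hTx : σ (T x) x = 0 ∧ σ (T x) (a x) = 0) :
    fderiv ℝ (fun y => σ (T y) (a (Z y))) x X = σ (liftConn σ a μ X T x) (a (Z x))
      + σ (T x) (a (liftConn σ a μ X Z x)) + σ (T x) (redEndDeriv σ a μ x X (Z x)) := by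
  have h1 : fderiv ℝ (fun y => a (Z y)) x X = a (fderiv ℝ Z x X) := by
    have := (a.hasFDerivAt.comp x hZ.hasFDerivAt).fderiv
    rw [Function.comp_def] at this
    rw [this]; rfl
  rw [fderiv_bilin hT (show DifferentiableAt ℝ (fun y => a (Z y)) x by fun_prop), h1]
  have e1 : σ x (a (Z x)) = 0 := by
    have h1 := ha x (Z x)
    have h2 := hσ (a x) (Z x)
    have h3 := hZx.2
    linarith
  have e2 : σ (a x) (a (Z x)) = σ (Z x) (a (a x)) := by
    have h1 := ha (Z x) (a x)
    have h2 := hσ (a (Z x)) (a x)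
    linarith
  have e3 : σ X (T x) = -σ (T x) X := hσ _ _
  have e4 : σ X (Z x) = -σ (Z x) X := hσ _ _
  simp only [liftConn, redEndDeriv, redVec, map_add, map_sub, map_smul,
    add_apply, smul_apply, smul_eq_mul, e1, e2, e3, e4, hZx.1, hTx.1, hTx.2]
  ring

/-- The covariant derivative of the curvature of the reduced connection. -/
lemma liftConn_liftCurv (hσ : ∀ v w, σ v w = -σ w v) (ha : ∀ v w, σ (a v) w = -σ v (a w))
    {Y Z T : V → V} {x X : V} (hY : DifferentiableAt ℝ Y x) (hZ : DifferentiableAt ℝ Z x)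
    (hT : DifferentiableAt ℝ T x) (hX : σ X x = 0 ∧ σ X (a x) = 0)
    (hYx : σ (Y x) x = 0 ∧ σ (Y x) (a x) = 0) (hZx : σ (Z x) x = 0 ∧ σ (Z x) (a x) = 0)
    (hTx : σ (T x) x = 0 ∧ σ (T x) (a x) = 0) :
    liftConn σ a μ X (fun y => liftCurv σ a μ y (Y y) (Z y) (T y)) x
        - liftCurv σ a μ x (liftConn σ a μ X Y x) (Z x) (T x)
        - liftCurv σ a μ x (Y x) (liftConn σ a μ X Z x) (T x)
        - liftCurv σ a μ x (Y x) (Z x) (liftConn σ a μ X T x)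
      = liftCurvDeriv σ a μ x X (Y x) (Z x) (T x) := by
  have h1 := differentiableAt_bilin (σ := σ) hY hZ
  have h2 := differentiableAt_bilin (σ := σ) hZ hT
  have h3 := differentiableAt_bilin (σ := σ) hY hT
  have h4 : DifferentiableAt ℝ (fun y => σ (T y) (a (Z y))) x :=
    differentiableAt_bilin hT (by fun_prop)
  have h5 : DifferentiableAt ℝ (fun y => σ (T y) (a (Y y))) x :=
    differentiableAt_bilin hT (by fun_prop)
  have h6 := differentiableAt_redEnd (σ := σ) (a := a) (μ := μ) hY
  have h7 := differentiableAt_redEnd (σ := σ) (a := a) (μ := μ) hZ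
  have h8 := differentiableAt_redEnd (σ := σ) (a := a) (μ := μ) hT
  have d1 : DifferentiableAt ℝ (fun y => -(2 * σ (Y y) (Z y))) x := by fun_prop
  have s1 := d1.fun_smul h8
  have s2 := h4.fun_smul hY
  have s3 := h5.fun_smul hZ
  have s4 := h2.fun_smul h6
  have s5 := h3.fun_smul h7
  have hd1 : fderiv ℝ (fun y => -(2 * σ (Y y) (Z y))) x X
      = -(2 * fderiv ℝ (fun y => σ (Y y) (Z y)) x X) := by
    rw [fderiv_fun_neg, fderiv_const_mul h1]
    simp
  have hexp : liftConn σ a μ X (fun y => liftCurv σ a μ y (Y y) (Z y) (T y)) x = (1 / μ) •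
      (liftConn σ a μ X (fun y => -(2 * σ (Y y) (Z y)) • redEnd σ a μ y (T y)) x
        + liftConn σ a μ X (fun y => σ (T y) (a (Z y)) • Y y) x
        - liftConn σ a μ X (fun y => σ (T y) (a (Y y)) • Z y) x
        + liftConn σ a μ X (fun y => σ (Z y) (T y) • redEnd σ a μ y (Y y)) x
        - liftConn σ a μ X (fun y => σ (Y y) (T y) • redEnd σ a μ y (Z y)) x) := by
    rw [← liftConn_add s1 s2, ← liftConn_sub (s1.fun_add s2) s3,
      ← liftConn_add ((s1.fun_add s2).fun_sub s3) s4,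
      ← liftConn_sub (((s1.fun_add s2).fun_sub s3).fun_add s4) s5]
    have := liftConn_smul (σ := σ) (a := a) (μ := μ) (differentiableAt_const (1 / μ))
      ((((s1.fun_add s2).fun_sub s3).fun_add s4).fun_sub s5) X
    simpa [liftCurv] using this
  -- Leibniz in each summand: terms differentiating Y, Z or T cancel against the three subtracted
  -- curvatures, and only derivatives of `redEnd` survive.
  rw [hexp, liftConn_smul d1 h8, liftConn_smul h4 hY, liftConn_smul h5 hZ, liftConn_smul h2 h6,
    liftConn_smul h3 h7, hd1, liftConn_redEnd hσ ha hT hTx hX, liftConn_redEnd hσ ha hY hYx hX,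
    liftConn_redEnd hσ ha hZ hZx hX, fderiv_bilin_map_eq (μ := μ) hσ ha hZ hT hZx hTx,
    fderiv_bilin_map_eq (μ := μ) hσ ha hY hT hYx hTx,
    fderiv_bilin_eq_liftConn (a := a) (μ := μ) hσ hY hZ hYx hZx,
    fderiv_bilin_eq_liftConn (a := a) (μ := μ) hσ hZ hT hZx hTx,
    fderiv_bilin_eq_liftConn (a := a) (μ := μ) hσ hY hT hYx hTx]
  simp only [liftCurv, liftCurvDeriv]
  module

/-- The covariant derivative of the curvature vanishes at `x` only if `a² x` has no horizontal
component. -/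
lemma bilin_redVec_eq_zero (hσ : ∀ v w, σ v w = -σ w v) (hμ : μ ≠ 0) {x T : V}
    (h : liftCurvDeriv σ a μ x (redVec σ a μ x) (redVec σ a μ x) T T = 0) :
    σ T (redVec σ a μ x) = 0 := by
  have h1 := congrArg (fun v => σ T v) h
  have e1 : σ T T = 0 := by linarith [hσ T T]
  have e2 : σ (redVec σ a μ x) (redVec σ a μ x) = 0 := by
    linarith [hσ (redVec σ a μ x) (redVec σ a μ x)]
  have e3 := hσ (redVec σ a μ x) T
  simp only [liftCurvDeriv, redEndDeriv, map_add, map_sub, map_smul, smul_eq_mul, e1, e2, e3,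
    map_zero] at h1
  -- The three surviving terms contribute 4, 2 and 2 times the cube.
  have h2 : (1 / μ) ^ 2 * (8 * (σ T (redVec σ a μ x)) ^ 3) = 0 := by linear_combination h1
  simpa [hμ] using h2

end Algebra

/-! ### The symplectic form, the flow, and the retraction of a cone onto the quadric. -/

section Quadric

variable {n : ℕ}

/-- The standard symplectic form as a continuous bilinear map. -/
noncomputable def omegaL (n : ℕ) : Vec n →L[ℝ] Vec n →L[ℝ] ℝ :=
  LinearMap.toContinuousBilinearMap <| LinearMap.mk₂ ℝ (omega (n := n))
    (fun x y z => by simp only [omega, ← Finset.sum_add_distrib, Pi.add_apply]; congr 1; ext; ring)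
    (fun c x y => by
      simp only [omega, Finset.mul_sum, Pi.smul_apply, smul_eq_mul]; congr 1; ext; ring)
    (fun x y z => by simp only [omega, ← Finset.sum_add_distrib, Pi.add_apply]; congr 1; ext; ring)
    (fun c x y => by
      simp only [omega, Finset.mul_sum, Pi.smul_apply, smul_eq_mul]; congr 1; ext; ring)

lemma omega_eq_omegaL (x y : Vec n) : omega x y = omegaL n x y := rfl

lemma omegaL_antisymm (x y : Vec n) : omegaL n x y = -omegaL n y x := by
  simp only [← omega_eq_omegaL, omega, ← Finset.sum_neg_distrib]
  congr 1; ext; ring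

lemma omegaL_self (x : Vec n) : omegaL n x x = 0 := by linarith [omegaL_antisymm x x]

lemma omegaL_nondegenerate {x : Vec n} (h : ∀ y, omegaL n y x = 0) : x = 0 := by
  ext i
  simp only [← omega_eq_omegaL, omega] at h
  rcases i with i | i
  · simpa [Pi.single_apply, Finset.sum_ite_eq] using h (Pi.single (Sum.inr i) 1)
  · simpa [Pi.single_apply, Finset.sum_ite_eq] using h (Pi.single (Sum.inl i) 1)

/-- A matrix as a continuous linear map. -/
noncomputable def actL (A : Mat n) : Vec n →L[ℝ] Vec n := LinearMap.toContinuousLinearMap A.mulVecLin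

lemma mulVec_eq_actL (A : Mat n) (x : Vec n) : A *ᵥ x = actL A x := rfl

variable {A : Mat n} {μ : ℝ}

lemma omegaL_actL (hA : A ∈ LieAlgebra.Symplectic.sp (Fin (n + 1)) ℝ) (x y : Vec n) :
    omegaL n (actL A x) y = -omegaL n x (actL A y) := (mem_sp_iff A).1 hA x y

variable (A) in
/-- The flow `ψ_t` as a continuous linear map. -/
noncomputable def flowL (t : ℝ) : Vec n →L[ℝ] Vec n := actL (NormedSpace.exp ((-2 * t) • A))

lemma flow_eq_flowL (t : ℝ) (x : Vec n) : flow A t x = flowL A t x := rfl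

lemma flowL_actL (t : ℝ) (x : Vec n) : flowL A t (actL A x) = actL A (flowL A t x) := by
  have h : Commute (NormedSpace.exp ((-2 * t) • A)) A := by
    let _ : SeminormedRing (Mat n) := Matrix.linftyOpSemiNormedRing
    let _ : NormedRing (Mat n) := Matrix.linftyOpNormedRing
    let _ : NormedAlgebra ℝ (Mat n) := Matrix.linftyOpNormedAlgebra
    let _ : NormedAlgebra ℚ (Mat n) := NormedAlgebra.restrictScalars ℚ ℝ (Mat n)
    exact ((Commute.refl A).smul_left _).exp_left
  change NormedSpace.exp ((-2 * t) • A) *ᵥ (A *ᵥ x) = A *ᵥ (NormedSpace.exp ((-2 * t) • A) *ᵥ x)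
  rw [Matrix.mulVec_mulVec, Matrix.mulVec_mulVec, h.eq]

lemma hasDerivAt_flowL (t : ℝ) (x : Vec n) :
    HasDerivAt (fun t => flowL A t x) ((-2 : ℝ) • actL A (flowL A t x)) t := by
  let _ : NormedRing (Mat n) := Matrix.linftyOpNormedRing
  let _ : NormedAlgebra ℝ (Mat n) := Matrix.linftyOpNormedAlgebra
  have h1 : HasDerivAt (fun s : ℝ => NormedSpace.exp (s • A)) (A * NormedSpace.exp ((-2 * t) • A))
      (-2 * t) := hasDerivAt_exp_smul_const' A (-2 * t)
  have h2 : HasDerivAt (fun s : ℝ => NormedSpace.exp ((-2 * s) • A))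
      ((-2 : ℝ) • (A * NormedSpace.exp ((-2 * t) • A))) t := by
    have h3 : HasDerivAt (fun s : ℝ => -2 * s) (-2) t := by
      simpa using (hasDerivAt_id t).const_mul (-2 : ℝ)
    exact HasDerivAt.scomp t h1 h3
  let L : Mat n →L[ℝ] Vec n := LinearMap.toContinuousLinearMap
    ((Matrix.mulVecBilin ℝ ℝ).flip x)
  have h4 := L.hasFDerivAt.comp_hasDerivAt t h2
  have h5 : (-2 : ℝ) • actL A (flowL A t x) = L ((-2 : ℝ) • (A * NormedSpace.exp ((-2 * t) • A))) := by
    rw [map_smul]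
    congr 1
    change A *ᵥ (NormedSpace.exp ((-2 * t) • A) *ᵥ x) = (A * NormedSpace.exp ((-2 * t) • A)) *ᵥ x
    rw [Matrix.mulVec_mulVec]
  rw [h5]
  exact h4

lemma flowL_zero (x : Vec n) : flowL A 0 x = x := flow_zero A x

/-- The derivative in t is -2(ω(Ax, y) + ω(x, Ay)) along the flow, which vanishes by skewness. -/
lemma omegaL_flowL (hA : A ∈ LieAlgebra.Symplectic.sp (Fin (n + 1)) ℝ) (t : ℝ) (x y : Vec n) :
    omegaL n (flowL A t x) (flowL A t y) = omegaL n x y := by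
  have h : ∀ s, HasDerivAt (fun t => omegaL n (flowL A t x) (flowL A t y)) 0 s := by
    intro s
    have h1 := ((omegaL n).hasFDerivAt_of_bilinear (hasDerivAt_flowL (A := A) s x).hasFDerivAt
      (hasDerivAt_flowL (A := A) s y).hasFDerivAt).hasDerivAt
    refine h1.congr_deriv ?_
    simp [omegaL_actL hA]
  have h2 := is_const_of_deriv_eq_zero (fun s => (h s).differentiableAt) (fun s => (h s).deriv) t 0
  simpa [flowL_zero] using h2

lemma hamiltonian_eq (x : Vec n) : hamiltonian A x = omegaL n x (actL A x) := rfl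

lemma mem_quadric_iff {x : Vec n} : x ∈ quadric A μ ↔ omegaL n x (actL A x) = μ := Iff.rfl

lemma hamiltonian_flowL (hA : A ∈ LieAlgebra.Symplectic.sp (Fin (n + 1)) ℝ) (t : ℝ) (x : Vec n) :
    hamiltonian A (flowL A t x) = hamiltonian A x := by
  rw [hamiltonian_eq, hamiltonian_eq, ← flowL_actL, omegaL_flowL hA]

lemma flowL_mem_quadric (hA : A ∈ LieAlgebra.Symplectic.sp (Fin (n + 1)) ℝ) (t : ℝ) {x : Vec n}
    (hx : x ∈ quadric A μ) : flowL A t x ∈ quadric A μ :=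
  (hamiltonian_flowL hA t x).trans hx

lemma contDiff_hamiltonian : ContDiff ℝ ∞ (hamiltonian A) := by
  change ContDiff ℝ ∞ (fun x => omegaL n x (actL A x))
  exact (omegaL n).contDiff.clm_apply (actL A).contDiff

lemma fderiv_hamiltonian (hA : A ∈ LieAlgebra.Symplectic.sp (Fin (n + 1)) ℝ) (x v : Vec n) :
    fderiv ℝ (hamiltonian A) x v = 2 * omegaL n v (actL A x) := by
  change fderiv ℝ (fun x => omegaL n (id x) (actL A x)) x v = _
  rw [fderiv_bilin differentiableAt_id (actL A).differentiableAt]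
  simp only [fderiv_id, ContinuousLinearMap.id_apply, ContinuousLinearMap.fderiv, id]
  have h1 := omegaL_actL hA x v
  have h2 := omegaL_antisymm (actL A x) v
  linarith

variable (A μ) in
/-- The open cone over the quadric. -/
def cone : Set (Vec n) := {x | 0 < μ / hamiltonian A x}

variable (A μ) in
/-- The radial retraction of the cone onto the quadric. -/
noncomputable def retr (x : Vec n) : Vec n := √(μ / hamiltonian A x) • x

/-- Division by zero gives 0, so the strict inequality defining `cone` excludes the zeros of H. -/
lemma hamiltonian_ne_zero {x : Vec n} (hx : x ∈ cone A μ) : hamiltonian A x ≠ 0 := by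
  intro h
  simp [cone, h] at hx

lemma isOpen_cone : IsOpen (cone A μ) := by
  have : cone A μ = {x | 0 < hamiltonian A x * μ} := by
    ext x
    simp only [cone, Set.mem_ofPred_eq]
    rw [div_pos_iff, mul_pos_iff, and_comm, and_comm (a := μ < 0)]
  rw [this]
  exact isOpen_lt continuous_const (contDiff_hamiltonian.continuous.mul continuous_const)

lemma quadric_subset_cone (hμ : μ ≠ 0) : quadric A μ ⊆ cone A μ := by
  intro x hx
  simp only [cone, Set.mem_ofPred_eq, show hamiltonian A x = μ from hx, div_self hμ, one_pos]

lemma retr_mem {x : Vec n} (hx : x ∈ cone A μ) : retr A μ x ∈ quadric A μ := by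
  rw [mem_quadric_iff, retr]
  simp only [map_smul, smul_apply, smul_eq_mul]
  rw [← mul_assoc, Real.mul_self_sqrt (le_of_lt hx), ← hamiltonian_eq,
    div_mul_cancel₀ _ (hamiltonian_ne_zero hx)]

lemma retr_of_mem (hμ : μ ≠ 0) {x : Vec n} (hx : x ∈ quadric A μ) : retr A μ x = x := by
  simp [retr, show hamiltonian A x = μ from hx, div_self hμ]

lemma retr_smul {x : Vec n} {c : ℝ} (hc : 0 < c) : retr A μ (c • x) = retr A μ x := by
  have : hamiltonian A (c • x) = c ^ 2 * hamiltonian A x := by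
    simp only [hamiltonian_eq, map_smul, smul_apply, smul_eq_mul]; ring
  rw [retr, retr, this, ← div_div, div_right_comm, Real.sqrt_div' _ (by positivity),
    Real.sqrt_sq hc.le, smul_smul, div_mul_cancel₀ _ hc.ne']

lemma retr_flowL (hA : A ∈ LieAlgebra.Symplectic.sp (Fin (n + 1)) ℝ) (t : ℝ) (x : Vec n) :
    retr A μ (flowL A t x) = flowL A t (retr A μ x) := by
  rw [retr, retr, hamiltonian_flowL hA, map_smul]

lemma contDiffAt_retr (hμ : μ ≠ 0) {x : Vec n} (hx : x ∈ cone A μ) :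
    ContDiffAt ℝ ∞ (retr A μ) x := by
  unfold retr
  exact ((contDiffAt_const.div contDiff_hamiltonian.contDiffAt (hamiltonian_ne_zero hx)).sqrt
    (div_ne_zero hμ (hamiltonian_ne_zero hx))).smul contDiffAt_id

lemma contDiffOn_retr (hμ : μ ≠ 0) : ContDiffOn ℝ ∞ (retr A μ) (cone A μ) :=
  fun _ hx => (contDiffAt_retr hμ hx).contDiffWithinAt

/-- A tangent vector is killed by dH, so the radial factor is stationary there, with value 1. -/
lemma fderiv_retr (hA : A ∈ LieAlgebra.Symplectic.sp (Fin (n + 1)) ℝ) (hμ : μ ≠ 0) {x : Vec n}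
    (hx : x ∈ quadric A μ) {v : Vec n} (hv : omegaL n v (actL A x) = 0) :
    fderiv ℝ (retr A μ) x v = v := by
  have hx' : hamiltonian A x = μ := hx
  have hc := quadric_subset_cone hμ hx
  have hH : HasFDerivAt (hamiltonian A) (fderiv ℝ (hamiltonian A) x) x :=
    (contDiff_hamiltonian.differentiable (by simp)).differentiableAt.hasFDerivAt
  have h0 := hamiltonian_ne_zero hc
  have h1 : HasFDerivAt (fun y => μ / hamiltonian A y)
      (-(μ / hamiltonian A x ^ 2) • fderiv ℝ (hamiltonian A) x) x := by
    have := (hasDerivAt_inv h0).comp_hasFDerivAt x hH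
    have := this.const_mul μ
    simp only [Function.comp_def, ← div_eq_mul_inv] at this
    refine this.congr_fderiv ?_
    ext w
    simp only [smul_apply, smul_eq_mul]
    ring
  have h2 := h1.sqrt (div_ne_zero hμ h0)
  have h3 := h2.smul (hasFDerivAt_id x)
  have h4 : fderiv ℝ (retr A μ) x = _ := h3.fderiv
  rw [h4]
  simp [fderiv_hamiltonian hA, hv, hx', hμ]

/-- Functions agreeing on the quadric have the same derivative in tangent directions. -/
lemma fderiv_eq_of_eqOn {G : Type*} [NormedAddCommGroup G] [NormedSpace ℝ G]
    (hA : A ∈ LieAlgebra.Symplectic.sp (Fin (n + 1)) ℝ) (hμ : μ ≠ 0) {f g : Vec n → G}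
    {x : Vec n} (hx : x ∈ quadric A μ) (hf : DifferentiableAt ℝ f x) (hg : DifferentiableAt ℝ g x)
    (hfg : ∃ u ∈ nhds x, Set.EqOn f g (quadric A μ ∩ u)) {v : Vec n}
    (hv : omegaL n v (actL A x) = 0) : fderiv ℝ f x v = fderiv ℝ g x v := by
  obtain ⟨u, hu, hfg⟩ := hfg
  have hc := quadric_subset_cone hμ hx
  have hr := (contDiffAt_retr hμ hc).differentiableAt (by simp)
  have hrx := retr_of_mem hμ hx
  have key : ∀ {h : Vec n → G}, DifferentiableAt ℝ h x →
      fderiv ℝ (h ∘ retr A μ) x v = fderiv ℝ h x v := by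
    intro h hh
    rw [fderiv_comp x (by rwa [hrx]) hr, hrx, ContinuousLinearMap.comp_apply,
      fderiv_retr hA hμ hx hv]
  -- Composition with the retraction turns agreement on Σ into agreement on a neighbourhood.
  have heq : f ∘ retr A μ =ᶠ[nhds x] g ∘ retr A μ := by
    have hu' : retr A μ ⁻¹' u ∈ nhds x := hr.continuousAt (by rwa [hrx])
    filter_upwards [isOpen_cone.mem_nhds hc, hu'] with y hy hyu
    exact hfg ⟨retr_mem hy, hyu⟩
  rw [← key hf, ← key hg, heq.fderiv_eq]

/-- The derivative along the quadric is the derivative of any extension. -/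
lemma fderivWithin_quadric {G : Type*} [NormedAddCommGroup G] [NormedSpace ℝ G]
    (hA : A ∈ LieAlgebra.Symplectic.sp (Fin (n + 1)) ℝ) (hμ : μ ≠ 0) {f g : Vec n → G}
    {x : Vec n} (hx : x ∈ quadric A μ) (hg : DifferentiableAt ℝ g x)
    (hfg : Set.EqOn f g (quadric A μ)) {v : Vec n}
    (hv : omegaL n v (actL A x) = 0) :
    fderivWithin ℝ f (quadric A μ) x v = fderiv ℝ g x v := by
  have hc := quadric_subset_cone hμ hx
  have hrx := retr_of_mem hμ hx
  have hr := (contDiffAt_retr hμ hc).differentiableAt (by simp)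
  rw [fderivWithin_congr hfg (hfg hx)]
  -- Derivatives within Σ are not unique, but any of them composed with that of the retraction is
  -- the genuine derivative of g ∘ `retr` on an open set.
  have h1 : HasFDerivWithinAt g (fderivWithin ℝ g (quadric A μ) x) (quadric A μ)
    (retr A μ x) := by
    rw [hrx]; exact hg.differentiableWithinAt.hasFDerivWithinAt
  have h2 := h1.comp x (hr.hasFDerivAt.hasFDerivWithinAt (s := cone A μ)) (fun y hy => retr_mem hy)
  have h3 := (h2.hasFDerivAt (isOpen_cone.mem_nhds hc)).fderiv
  have h4 : fderiv ℝ (g ∘ retr A μ) x v = fderiv ℝ g x v := by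
    rw [fderiv_comp x (by rwa [hrx]) hr, hrx, ContinuousLinearMap.comp_apply,
      fderiv_retr hA hμ hx hv]
  rw [← h4, h3, ContinuousLinearMap.comp_apply, fderiv_retr hA hμ hx hv]

lemma flowL_mem_cone (hA : A ∈ LieAlgebra.Symplectic.sp (Fin (n + 1)) ℝ) (t : ℝ)
    {x : Vec n} (hx : x ∈ cone A μ) : flowL A t x ∈ cone A μ := by
  rw [cone, Set.mem_ofPred_eq, hamiltonian_flowL hA]; exact hx

lemma omegaL_actL_self {x : Vec n} (hx : x ∈ quadric A μ) : omegaL n (actL A x) x = -μ := by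
  rw [omegaL_antisymm, mem_quadric_iff.1 hx]

variable (A) in
/-- The horizontal projection at a point of the quadric. -/
noncomputable def horProj (μ : ℝ) (x v : Vec n) : Vec n :=
  v - (1 / μ * omegaL n v (actL A x)) • x + (1 / μ * omegaL n v x) • actL A x

lemma mem_horizontal_iff {x v : Vec n} :
    v ∈ horizontal A x ↔ omegaL n v x = 0 ∧ omegaL n v (actL A x) = 0 := Iff.rfl

lemma horProj_mem (hμ : μ ≠ 0) {x : Vec n} (hx : x ∈ quadric A μ) (v : Vec n) :
    horProj A μ x v ∈ horizontal A x := by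
  have h1 := mem_quadric_iff.1 hx
  have h2 := omegaL_actL_self hx
  rw [mem_horizontal_iff, horProj]
  constructor
  · simp only [map_add, map_sub, map_smul, add_apply, sub_apply, smul_apply, omegaL_self, h2,
      smul_eq_mul]
    field_simp
    ring
  · simp only [map_add, map_sub, map_smul, add_apply, sub_apply, smul_apply, omegaL_self, h1,
      smul_eq_mul]
    field_simp
    ring

lemma horizontal_sub {x v w : Vec n} (hv : v ∈ horizontal A x) (hw : w ∈ horizontal A x) :
    v - w ∈ horizontal A x := by
  rw [mem_horizontal_iff] at *
  simp [hv.1, hv.2, hw.1, hw.2]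

lemma flowL_mem_horizontal (hA : A ∈ LieAlgebra.Symplectic.sp (Fin (n + 1)) ℝ) (t : ℝ)
    {x v : Vec n} (hv : v ∈ horizontal A x) : flowL A t v ∈ horizontal A (flowL A t x) := by
  rw [mem_horizontal_iff] at *
  rw [← flowL_actL, omegaL_flowL hA, omegaL_flowL hA]
  exact hv

/-- Only tangential derivatives enter, so values on Σ suffice. -/
lemma liftConn_congr (hA : A ∈ LieAlgebra.Symplectic.sp (Fin (n + 1)) ℝ) (hμ : μ ≠ 0)
    {f g : Vec n → Vec n} {x : Vec n} (hx : x ∈ quadric A μ) (hf : DifferentiableAt ℝ f x)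
    (hg : DifferentiableAt ℝ g x) (hfg : Set.EqOn f g (quadric A μ)) {X : Vec n}
    (hX : omegaL n X (actL A x) = 0) :
    liftConn (omegaL n) (actL A) μ X f x = liftConn (omegaL n) (actL A) μ X g x := by
  rw [liftConn, liftConn, hfg hx, fderiv_eq_of_eqOn hA hμ hx hf hg
    ⟨Set.univ, Filter.univ_mem, fun y hy => hfg hy.1⟩ hX]

lemma contDiffAt_liftConn {f g : Vec n → Vec n} {x : Vec n} (hf : ContDiffAt ℝ ∞ f x)
    (hg : ContDiffAt ℝ ∞ g x) :
    ContDiffAt ℝ ∞ (fun y => liftConn (omegaL n) (actL A) μ (f y) g y) x := by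
  unfold liftConn
  have h1 := (hg.fderiv_right (m := ∞) (by simp)).clm_apply hf
  have h2 : ContDiffAt ℝ ∞ (fun y => omegaL n (g y) (actL A (f y))) x :=
    ((omegaL n).contDiff.contDiffAt.comp x hg).clm_apply ((actL A).contDiff.contDiffAt.comp x hf)
  have h3 : ContDiffAt ℝ ∞ (fun y => omegaL n (f y) (g y)) x :=
    ((omegaL n).contDiff.contDiffAt.comp x hf).clm_apply hg
  exact (h1.add ((contDiffAt_const.mul h2).smul contDiffAt_id)).add
    ((contDiffAt_const.mul h3).smul (actL A).contDiff.contDiffAt)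

lemma redEnd_horizontal (hA : A ∈ LieAlgebra.Symplectic.sp (Fin (n + 1)) ℝ) (hμ : μ ≠ 0)
    {x v : Vec n} (hx : x ∈ quadric A μ) (hv : v ∈ horizontal A x) :
    redEnd (omegaL n) (actL A) μ x v ∈ horizontal A x := by
  rw [mem_horizontal_iff] at hv
  rw [mem_horizontal_iff, redEnd]
  simp only [map_add, map_smul, add_apply, smul_apply, smul_eq_mul, omegaL_self,
    omegaL_actL hA v, hv.2, mem_quadric_iff.1 hx]
  constructor
  · simp
  · field_simp
    ring

lemma liftCurv_horizontal (hA : A ∈ LieAlgebra.Symplectic.sp (Fin (n + 1)) ℝ) (hμ : μ ≠ 0)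
    {x Y Z T : Vec n} (hx : x ∈ quadric A μ) (hY : Y ∈ horizontal A x) (hZ : Z ∈ horizontal A x)
    (hT : T ∈ horizontal A x) : liftCurv (omegaL n) (actL A) μ x Y Z T ∈ horizontal A x := by
  have h1 := redEnd_horizontal hA hμ hx hY
  have h2 := redEnd_horizontal hA hμ hx hZ
  have h3 := redEnd_horizontal hA hμ hx hT
  rw [mem_horizontal_iff] at *
  simp [liftCurv, hY.1, hY.2, hZ.1, hZ.2, h1.1, h1.2, h2.1, h2.2, h3.1, h3.2]

end Quadric

/-! ### Tangent vectors of M read in the model space. -/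

section ModelValue

variable {n : ℕ} {A : Mat n} {μ : ℝ}
  [ChartedSpace (EuclideanSpace ℝ (Fin (2 * n))) (ReducedSpace A μ)]

/-- A vector field as a function with values in the model space. -/
def VField.val (Y : VField A μ) (y : ReducedSpace A μ) : EuclideanSpace ℝ (Fin (2 * n)) := Y y

end ModelValue

/-! ### The differential of the projection, and horizontal lifts. -/

section Projection

variable {n : ℕ} {A : Mat n} {μ : ℝ} [Nonempty (quadric A μ)]

lemma proj_of_mem {x : Vec n} (hx : x ∈ quadric A μ) :
    proj A μ x = Quotient.mk (orbitSetoid A μ) ⟨x, hx⟩ := by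
  rw [proj, dif_pos hx]

lemma exists_proj_eq (y : ReducedSpace A μ) : ∃ x ∈ quadric A μ, proj A μ x = y := by
  induction y using Quotient.inductionOn with
  | h x => exact ⟨x, x.2, proj_of_mem x.2⟩

lemma proj_eq_iff {x y : Vec n} (hx : x ∈ quadric A μ) (hy : y ∈ quadric A μ) :
    proj A μ x = proj A μ y ↔ ∃ t, flowL A t x = y := by
  rw [proj_of_mem hx, proj_of_mem hy, Quotient.eq]
  exact Iff.rfl

lemma proj_flowL (hA : A ∈ LieAlgebra.Symplectic.sp (Fin (n + 1)) ℝ) (t : ℝ) {x : Vec n}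
    (hx : x ∈ quadric A μ) : proj A μ (flowL A t x) = proj A μ x :=
  ((proj_eq_iff hx (flowL_mem_quadric hA t hx)).2 ⟨t, rfl⟩).symm

variable (A μ) in
/-- The extension of the projection to the cone over the quadric. -/
noncomputable def coneProj (x : Vec n) : ReducedSpace A μ := proj A μ (retr A μ x)

lemma coneProj_of_mem (hμ : μ ≠ 0) {x : Vec n} (hx : x ∈ quadric A μ) :
    coneProj A μ x = proj A μ x := by
  rw [coneProj, retr_of_mem hμ hx]

lemma coneProj_flowL (hA : A ∈ LieAlgebra.Symplectic.sp (Fin (n + 1)) ℝ) (t : ℝ)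
    {x : Vec n} (hx : x ∈ cone A μ) : coneProj A μ (flowL A t x) = coneProj A μ x := by
  rw [coneProj, retr_flowL hA, proj_flowL hA t (retr_mem hx), coneProj]

variable [ChartedSpace (EuclideanSpace ℝ (Fin (2 * n))) (ReducedSpace A μ)]

lemma contMDiffAt_coneProj (hμ : μ ≠ 0) (hπ : IsSmoothSubmersion A μ) {x : Vec n}
    (hx : x ∈ cone A μ) : ContMDiffAt 𝓘(ℝ, Vec n) (𝓡 (2 * n)) ∞ (coneProj A μ) x := by
  have h1 : ContMDiffOn 𝓘(ℝ, Vec n) 𝓘(ℝ, Vec n) ∞ (retr A μ) (cone A μ) :=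
    (contDiffOn_retr hμ).contMDiffOn
  exact (hπ.1.comp h1 (fun _ h => retr_mem h)).contMDiffAt (isOpen_cone.mem_nhds hx)

lemma mdifferentiableAt_coneProj (hμ : μ ≠ 0) (hπ : IsSmoothSubmersion A μ) {x : Vec n}
    (hx : x ∈ cone A μ) : MDifferentiableAt 𝓘(ℝ, Vec n) (𝓡 (2 * n)) (coneProj A μ) x :=
  (contMDiffAt_coneProj hμ hπ hx).mdifferentiableAt (by simp)

variable (A μ) in
/-- The differential of `coneProj`, with values in the model space. -/
noncomputable def dcone (x : Vec n) : Vec n →L[ℝ] EuclideanSpace ℝ (Fin (2 * n)) :=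
  mfderiv 𝓘(ℝ, Vec n) (𝓡 (2 * n)) (coneProj A μ) x

/-- The derivative of π within Σ is ambiguous as a linear map on the ambient space. Its values on
tangent vectors are fixed by the chain rule, because the retraction acts there as the identity to
first order. -/
lemma dproj_eq_dcone (hA : A ∈ LieAlgebra.Symplectic.sp (Fin (n + 1)) ℝ) (hμ : μ ≠ 0)
    (hπ : IsSmoothSubmersion A μ) {x : Vec n} (hx : x ∈ quadric A μ) {v : Vec n}
    (hv : omegaL n v (actL A x) = 0) : (dproj A μ x v : EuclideanSpace ℝ (Fin (2 * n)))
      = dcone A μ x v := by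
  have hc := quadric_subset_cone hμ hx
  have h1 : MDifferentiableWithinAt 𝓘(ℝ, Vec n) (𝓡 (2 * n)) (proj A μ) (quadric A μ) x :=
    (hπ.1 x hx).mdifferentiableWithinAt (by simp)
  have h2 : MDifferentiableWithinAt 𝓘(ℝ, Vec n) 𝓘(ℝ, Vec n) (retr A μ) (cone A μ) x :=
    ((contDiffAt_retr hμ hc).differentiableAt (by simp)).differentiableWithinAt.mdifferentiableWithinAt
  have h3 := mfderivWithin_comp_of_eq h1 h2 (fun _ h => retr_mem h)
    (isOpen_cone.uniqueMDiffWithinAt hc) (retr_of_mem hμ hx)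
  have h4 : mfderivWithin 𝓘(ℝ, Vec n) (𝓡 (2 * n)) (proj A μ ∘ retr A μ) (cone A μ) x
      = dcone A μ x := mfderivWithin_of_isOpen isOpen_cone hc
  have h5 : mfderivWithin 𝓘(ℝ, Vec n) 𝓘(ℝ, Vec n) (retr A μ) (cone A μ) x v = v := by
    rw [mfderivWithin_eq_fderivWithin, fderivWithin_of_isOpen isOpen_cone hc]
    exact fderiv_retr hA hμ hx hv
  have h6 := congrArg (fun L : Vec n →L[ℝ] EuclideanSpace ℝ (Fin (2 * n)) => L v) (h4.symm.trans h3)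
  refine Eq.trans ?_ h6.symm
  change _ = mfderivWithin 𝓘(ℝ, Vec n) (𝓡 (2 * n)) (proj A μ) (quadric A μ) x
    (mfderivWithin 𝓘(ℝ, Vec n) 𝓘(ℝ, Vec n) (retr A μ) (cone A μ) x v)
  rw [h5]
  rfl

lemma hasMFDerivAt_coneProj (hμ : μ ≠ 0) (hπ : IsSmoothSubmersion A μ) {x : Vec n}
    (hx : x ∈ cone A μ) :
    HasMFDerivAt 𝓘(ℝ, Vec n) (𝓡 (2 * n)) (coneProj A μ) x (dcone A μ x) :=
  (mdifferentiableAt_coneProj hμ hπ hx).hasMFDerivAt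

lemma dcone_flowL (hA : A ∈ LieAlgebra.Symplectic.sp (Fin (n + 1)) ℝ) (hμ : μ ≠ 0)
    (hπ : IsSmoothSubmersion A μ) (t : ℝ) {x : Vec n} (hx : x ∈ cone A μ) (v : Vec n) :
    dcone A μ (flowL A t x) (flowL A t v) = dcone A μ x v := by
  have h1 : coneProj A μ ∘ flowL A t =ᶠ[𝓝 x] coneProj A μ := by
    filter_upwards [isOpen_cone.mem_nhds hx] with y hy
    exact coneProj_flowL hA t hy
  have h2 : HasMFDerivAt 𝓘(ℝ, Vec n) 𝓘(ℝ, Vec n) (flowL A t) x (flowL A t) :=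
    (flowL A t).hasFDerivAt.hasMFDerivAt
  have h3 := (hasMFDerivAt_coneProj hμ hπ hx).congr_of_eventuallyEq h1
  have h4 := (hasMFDerivAt_coneProj hμ hπ (flowL_mem_cone hA t hx)).comp x h2
  have h5 : (dcone A μ (flowL A t x)).comp (flowL A t) = dcone A μ x :=
    hasMFDerivAt_unique h4 h3
  rw [← h5, ContinuousLinearMap.comp_apply]

/-- `coneProj` is constant along a curve, so its differential kills the velocity. -/
lemma dcone_of_curve (hμ : μ ≠ 0) (hπ : IsSmoothSubmersion A μ) {x v : Vec n}
    (hx : x ∈ cone A μ) {γ : ℝ → Vec n} (h0 : γ 0 = x) (hγ : HasDerivAt γ v 0)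
    (hc : ∀ᶠ t in 𝓝 0, coneProj A μ (γ t) = coneProj A μ x) : dcone A μ x v = 0 := by
  subst h0
  have h1 : (fun _ => coneProj A μ (γ 0)) =ᶠ[𝓝 0] coneProj A μ ∘ γ := by
    filter_upwards [hc] with t ht
    exact ht.symm
  have h2 : HasMFDerivAt 𝓘(ℝ, ℝ) 𝓘(ℝ, Vec n) γ 0 (ContinuousLinearMap.toSpanSingleton ℝ v) :=
    hγ.hasFDerivAt.hasMFDerivAt
  have h3 := (hasMFDerivAt_coneProj hμ hπ hx).comp 0 h2
  have h4 : HasMFDerivAt 𝓘(ℝ, ℝ) (𝓡 (2 * n)) (fun _ : ℝ => coneProj A μ (γ 0)) 0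
      (0 : ℝ →L[ℝ] EuclideanSpace ℝ (Fin (2 * n))) := hasMFDerivAt_const _ _
  have h5 : (dcone A μ (γ 0)).comp (ContinuousLinearMap.toSpanSingleton ℝ v) = 0 :=
    hasMFDerivAt_unique (h3.congr_of_eventuallyEq h1) h4
  have h6 := congrArg (fun L => L 1) h5
  simpa using h6

/-- The retraction collapses rays, so the extended projection is constant along them. -/
lemma dcone_self (hμ : μ ≠ 0) (hπ : IsSmoothSubmersion A μ) {x : Vec n}
    (hx : x ∈ cone A μ) : dcone A μ x x = 0 := by
  refine dcone_of_curve hμ hπ hx (γ := fun t : ℝ => (1 + t) • x) (by simp) ?_ ?_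
  · simpa using ((hasDerivAt_id (0 : ℝ)).const_add 1).smul_const x
  · filter_upwards [eventually_gt_nhds (show (-1 : ℝ) < 0 by simp)] with t ht
    rw [coneProj, retr_smul (by linarith), coneProj]

lemma dcone_actL (hA : A ∈ LieAlgebra.Symplectic.sp (Fin (n + 1)) ℝ) (hμ : μ ≠ 0)
    (hπ : IsSmoothSubmersion A μ) {x : Vec n} (hx : x ∈ cone A μ) :
    dcone A μ x (actL A x) = 0 := by
  have h := dcone_of_curve hμ hπ hx (flowL_zero x) (hasDerivAt_flowL 0 x)
    (Filter.Eventually.of_forall fun t => coneProj_flowL hA t hx)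
  simpa [flowL_zero] using h

lemma dcone_surjective (hA : A ∈ LieAlgebra.Symplectic.sp (Fin (n + 1)) ℝ) (hμ : μ ≠ 0)
    (hπ : IsSmoothSubmersion A μ) {x : Vec n} (hx : x ∈ quadric A μ) :
    Function.Surjective (dcone A μ x) := by
  intro w
  obtain ⟨v, hv, h⟩ := hπ.2 x hx w
  exact ⟨v, (dproj_eq_dcone hA hμ hπ hx hv).symm.trans h⟩

lemma dcone_horProj (hA : A ∈ LieAlgebra.Symplectic.sp (Fin (n + 1)) ℝ) (hμ : μ ≠ 0)
    (hπ : IsSmoothSubmersion A μ) {x : Vec n} (hx : x ∈ quadric A μ) (v : Vec n) :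
    dcone A μ x (horProj A μ x v) = dcone A μ x v := by
  have hc := quadric_subset_cone hμ hx
  simp [horProj, dcone_self hμ hπ hc, dcone_actL hA hμ hπ hc]

variable (A μ) in
/-- The differential of the projection together with the two functionals defining the horizontal
space. -/
noncomputable def frameMap (x : Vec n) :
    Vec n →L[ℝ] EuclideanSpace ℝ (Fin (2 * n)) × ℝ × ℝ :=
  (dcone A μ x).prod (((omegaL n).flip x).prod ((omegaL n).flip (actL A x)))

lemma frameMap_apply (x v : Vec n) :
    frameMap A μ x v = (dcone A μ x v, omegaL n v x, omegaL n v (actL A x)) := rfl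

/-- Both sides have dimension 2n+2, so surjectivity is enough. This map is what makes horizontal
lifts exist, be unique and depend smoothly on the point. -/
lemma bijective_frameMap (hA : A ∈ LieAlgebra.Symplectic.sp (Fin (n + 1)) ℝ) (hμ : μ ≠ 0)
    (hπ : IsSmoothSubmersion A μ) {x : Vec n} (hx : x ∈ quadric A μ) :
    Function.Bijective (frameMap A μ x) := by
  have hsurj : Function.Surjective (frameMap A μ x) := by
    rintro ⟨w, c, d⟩
    obtain ⟨v, rfl⟩ := dcone_surjective hA hμ hπ hx w
    have hc := quadric_subset_cone hμ hx
    have h1 := mem_quadric_iff.1 hx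
    have h2 := omegaL_actL_self hx
    obtain ⟨h3, h4⟩ := horProj_mem hμ hx v
    -- The horizontal part accounts for w. Multiples of x and Ax lie in the kernel of dπ and adjust
    -- the two functionals, since ω(x, Ax) = μ = -ω(Ax, x).
    refine ⟨horProj A μ x v + (d / μ) • x - (c / μ) • actL A x, ?_⟩
    rw [frameMap_apply]
    rw [omega_eq_omegaL] at h3 h4
    rw [mulVec_eq_actL] at h4
    simp only [map_add, map_sub, map_smul, add_apply, sub_apply, smul_apply, omegaL_self, h1, h2,
      smul_eq_mul, h3, h4, dcone_horProj hA hμ hπ hx, dcone_self hμ hπ hc, dcone_actL hA hμ hπ hc]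
    ext <;> simp [hμ]
  have hdim : Module.finrank ℝ (Vec n)
      = Module.finrank ℝ (EuclideanSpace ℝ (Fin (2 * n)) × ℝ × ℝ) := by
    simp
    ring
  exact ⟨(LinearMap.injective_iff_surjective_of_finrank_eq_finrank hdim
    (f := (frameMap A μ x).toLinearMap)).2 hsurj, hsurj⟩

lemma eq_of_dcone_eq (hA : A ∈ LieAlgebra.Symplectic.sp (Fin (n + 1)) ℝ) (hμ : μ ≠ 0)
    (hπ : IsSmoothSubmersion A μ) {x : Vec n} (hx : x ∈ quadric A μ) {v w : Vec n}
    (hv : v ∈ horizontal A x) (hw : w ∈ horizontal A x) (h : dcone A μ x v = dcone A μ x w) :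
    v = w := by
  rw [mem_horizontal_iff] at hv hw
  apply (bijective_frameMap hA hμ hπ hx).1
  rw [frameMap_apply, frameMap_apply, h, hv.1, hv.2, hw.1, hw.2]

/-- The choice in `lift` is not vacuous: the horizontal projection of any preimage under dπ is a
candidate. -/
lemma lift_spec (hA : A ∈ LieAlgebra.Symplectic.sp (Fin (n + 1)) ℝ) (hμ : μ ≠ 0)
    (hπ : IsSmoothSubmersion A μ) (Y : VField A μ) {x : Vec n} (hx : x ∈ quadric A μ) :
    lift Y x ∈ horizontal A x ∧ dcone A μ x (lift Y x) = Y.val (proj A μ x) := by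
  obtain ⟨v, hv⟩ := dcone_surjective hA hμ hπ hx (Y.val (proj A μ x))
  have h1 := horProj_mem hμ hx v
  have h2 : dproj A μ x (horProj A μ x v) = Y (proj A μ x) :=
    (dproj_eq_dcone hA hμ hπ hx h1.2).trans ((dcone_horProj hA hμ hπ hx v).trans hv)
  have h3 : lift Y x ∈ horizontal A x ∧ dproj A μ x (lift Y x) = Y (proj A μ x) :=
    Classical.epsilon_spec (p := fun v => v ∈ horizontal A x ∧ dproj A μ x v = Y (proj A μ x))
      ⟨_, h1, h2⟩
  exact ⟨h3.1, (dproj_eq_dcone hA hμ hπ hx h3.1.2).symm.trans h3.2⟩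

lemma lift_eq (hA : A ∈ LieAlgebra.Symplectic.sp (Fin (n + 1)) ℝ) (hμ : μ ≠ 0)
    (hπ : IsSmoothSubmersion A μ) (Y : VField A μ) {x : Vec n} (hx : x ∈ quadric A μ) {v : Vec n}
    (hv : v ∈ horizontal A x) (h : dcone A μ x v = Y.val (proj A μ x)) : lift Y x = v :=
  eq_of_dcone_eq hA hμ hπ hx (lift_spec hA hμ hπ Y hx).1 hv
    ((lift_spec hA hμ hπ Y hx).2.trans h.symm)

lemma lift_sub (hA : A ∈ LieAlgebra.Symplectic.sp (Fin (n + 1)) ℝ) (hμ : μ ≠ 0)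
    (hπ : IsSmoothSubmersion A μ) (Y Z : VField A μ) {x : Vec n} (hx : x ∈ quadric A μ) :
    lift (Y - Z) x = lift Y x - lift Z x := by
  obtain ⟨h1, h2⟩ := lift_spec hA hμ hπ Y hx
  obtain ⟨h3, h4⟩ := lift_spec hA hμ hπ Z hx
  refine lift_eq hA hμ hπ _ hx (horizontal_sub h1 h3) ?_
  rw [map_sub, h2, h4]
  rfl

lemma eq_of_lift_eq (hA : A ∈ LieAlgebra.Symplectic.sp (Fin (n + 1)) ℝ) (hμ : μ ≠ 0)
    (hπ : IsSmoothSubmersion A μ) {Y Z : VField A μ}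
    (h : ∀ x ∈ quadric A μ, lift Y x = lift Z x) : Y = Z := by
  funext y
  obtain ⟨x, hx, rfl⟩ := exists_proj_eq y
  have h1 := (lift_spec hA hμ hπ Y hx).2
  rw [h x hx, (lift_spec hA hμ hπ Z hx).2] at h1
  exact h1.symm

lemma lift_zero (hA : A ∈ LieAlgebra.Symplectic.sp (Fin (n + 1)) ℝ) (hμ : μ ≠ 0)
    (hπ : IsSmoothSubmersion A μ) {x : Vec n} (hx : x ∈ quadric A μ) :
    lift (0 : VField A μ) x = 0 :=
  lift_eq hA hμ hπ _ hx (by rw [mem_horizontal_iff]; simp) (map_zero _)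

/-- The flow preserves the horizontal spaces and π, so uniqueness of lifts applies. -/
lemma lift_flowL (hA : A ∈ LieAlgebra.Symplectic.sp (Fin (n + 1)) ℝ) (hμ : μ ≠ 0)
    (hπ : IsSmoothSubmersion A μ) (Y : VField A μ) (t : ℝ) {x : Vec n} (hx : x ∈ quadric A μ) :
    lift Y (flowL A t x) = flowL A t (lift Y x) := by
  obtain ⟨h1, h2⟩ := lift_spec hA hμ hπ Y hx
  refine lift_eq hA hμ hπ Y (flowL_mem_quadric hA t hx) (flowL_mem_horizontal hA t h1) ?_
  rw [dcone_flowL hA hμ hπ t (quadric_subset_cone hμ hx), h2, proj_flowL hA t hx]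

end Projection

/-! ### Vector fields on M in coordinates. -/

section Charts

variable {n : ℕ} {A : Mat n} {μ : ℝ}
  [ChartedSpace (EuclideanSpace ℝ (Fin (2 * n))) (ReducedSpace A μ)]

/-- The coordinates of a vector field in the preferred chart at `y₀`. -/
noncomputable def chartField (y₀ : ReducedSpace A μ) (Y : VField A μ) :
    EuclideanSpace ℝ (Fin (2 * n)) → EuclideanSpace ℝ (Fin (2 * n)) :=
  VectorField.mpullbackWithin 𝓘(ℝ, EuclideanSpace ℝ (Fin (2 * n))) (𝓡 (2 * n))
    (extChartAt (𝓡 (2 * n)) y₀).symm Y (Set.range (𝓡 (2 * n)))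

/-- The differential of the preferred chart at `y₀`. -/
noncomputable def dchart (y₀ y : ReducedSpace A μ) :
    EuclideanSpace ℝ (Fin (2 * n)) →L[ℝ] EuclideanSpace ℝ (Fin (2 * n)) :=
  mfderiv (𝓡 (2 * n)) 𝓘(ℝ, EuclideanSpace ℝ (Fin (2 * n))) (extChartAt (𝓡 (2 * n)) y₀) y

variable [IsManifold (𝓡 (2 * n)) ∞ (ReducedSpace A μ)]

instance isManifold_one : IsManifold (𝓡 (2 * n)) 1 (ReducedSpace A μ) :=
  IsManifold.of_le (n := ∞) (by simp)

lemma dchart_self (y₀ : ReducedSpace A μ) : dchart y₀ y₀ = ContinuousLinearMap.id ℝ _ :=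
  mfderiv_extChartAt_self

lemma isInvertible_dchart {y₀ y : ReducedSpace A μ} (hy : y ∈ (extChartAt (𝓡 (2 * n)) y₀).source) :
    (dchart y₀ y).IsInvertible :=
  isInvertible_mfderiv_extChartAt hy

/-- Pulling back by the inverse chart applies the inverse of its differential, which is the
differential of the chart. -/
lemma chartField_apply {y₀ y : ReducedSpace A μ} (hy : y ∈ (extChartAt (𝓡 (2 * n)) y₀).source)
    (Y : VField A μ) :
    chartField y₀ Y (extChartAt (𝓡 (2 * n)) y₀ y) = dchart y₀ y (Y.val y) := by
  have h1 := mfderiv_extChartAt_comp_mfderivWithin_extChartAt_symm' (I := 𝓡 (2 * n)) hy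
  have h2 := mfderivWithin_extChartAt_symm_comp_mfderiv_extChartAt' (I := 𝓡 (2 * n)) hy
  have h3 : Y.val ((extChartAt (𝓡 (2 * n)) y₀).symm (extChartAt (𝓡 (2 * n)) y₀ y)) = Y.val y := by
    rw [(extChartAt (𝓡 (2 * n)) y₀).left_inv hy]
  let L : EuclideanSpace ℝ (Fin (2 * n)) →L[ℝ] EuclideanSpace ℝ (Fin (2 * n)) :=
    mfderivWithin 𝓘(ℝ, EuclideanSpace ℝ (Fin (2 * n))) (𝓡 (2 * n))
      (extChartAt (𝓡 (2 * n)) y₀).symm (Set.range (𝓡 (2 * n))) (extChartAt (𝓡 (2 * n)) y₀ y)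
  have h1' : (dchart y₀ y).comp L = ContinuousLinearMap.id ℝ _ := h1
  have h2' : L.comp (dchart y₀ y) = ContinuousLinearMap.id ℝ _ := h2
  have h4 : chartField y₀ Y (extChartAt (𝓡 (2 * n)) y₀ y) = L.inverse
    (Y.val ((extChartAt (𝓡 (2 * n)) y₀).symm (extChartAt (𝓡 (2 * n)) y₀ y))) := rfl
  rw [h4, h3, ContinuousLinearMap.inverse_eq h2' h1']

lemma contDiffAt_chartField {Y : VField A μ} (hY : IsSmooth Y) (y₀ : ReducedSpace A μ) :
    ContDiffAt ℝ ∞ (chartField y₀ Y) (extChartAt (𝓡 (2 * n)) y₀ y₀) := by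
  have h1 := VectorField.contMDiffWithinAt_mpullbackWithin_extChartAt_symm (n := ∞) (m := ∞)
    (I := 𝓡 (2 * n)) (s := Set.univ) (x := y₀) (V := Y) (hY y₀).contMDiffWithinAt
    uniqueMDiffOn_univ (Set.mem_univ _) (by simp)
  have h2 := contMDiffWithinAt_vectorSpace_iff_contDiffWithinAt.1 h1
  refine h2.contDiffAt ?_
  simpa using extChartAt_target_mem_nhds (I := 𝓡 (2 * n)) y₀

/-- Checking at chart centres is enough: every point is the centre of its own preferred chart. -/
lemma isSmooth_of_chartField {Y : VField A μ}
    (hY : ∀ y₀, ContDiffAt ℝ ∞ (chartField y₀ Y) (extChartAt (𝓡 (2 * n)) y₀ y₀)) :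
    IsSmooth Y := by
  intro y₀
  have h1 := contMDiffAt_vectorSpace_iff_contDiffAt.2 (hY y₀)
  have h2 := ContMDiffAt.mpullback_vectorField_preimage (n := ∞) (m := ∞) (I := 𝓡 (2 * n))
    (f := extChartAt (𝓡 (2 * n)) y₀) (x₀ := y₀) h1 contMDiffAt_extChartAt
    (isInvertible_mfderiv_extChartAt (mem_extChartAt_source y₀)) (by simp)
  refine h2.congr_of_eventuallyEq ?_
  have h3 := VectorField.eventuallyEq_mpullback_mpullbackWithin_extChartAt (I := 𝓡 (2 * n))
    (s := Set.univ) (x := y₀) Y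
  rw [nhdsWithin_univ] at h3
  filter_upwards [h3] with y hy
  exact congrArg _ hy

lemma hasMFDerivAt_extChart {y₀ y : ReducedSpace A μ}
    (hy : y ∈ (extChartAt (𝓡 (2 * n)) y₀).source) :
    HasMFDerivAt (𝓡 (2 * n)) 𝓘(ℝ, EuclideanSpace ℝ (Fin (2 * n))) (extChartAt (𝓡 (2 * n)) y₀) y
      (dchart y₀ y) :=
  (mdifferentiableAt_extChartAt (by rwa [extChartAt_source] at hy)).hasMFDerivAt

lemma isSmooth_mlieBracket {Y Z : VField A μ} (hY : IsSmooth Y) (hZ : IsSmooth Z) :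
    IsSmooth (VectorField.mlieBracket (𝓡 (2 * n)) Y Z : VField A μ) := by
  have : IsManifold (𝓡 (2 * n)) (∞ + 1) (ReducedSpace A μ) := IsManifold.of_le (n := ∞) (by simp)
  have : IsManifold (𝓡 (2 * n)) (minSmoothness ℝ 2) (ReducedSpace A μ) :=
    IsManifold.of_le (n := ∞) (by simp; exact WithTop.coe_le_coe.2 (le_top : (2 : ℕ∞) ≤ ⊤))
  exact ContDiff.mlieBracket_vectorField (m := ⊤) (n := ⊤) hY hZ (by simp)

lemma isSmooth_sub {Y Z : VField A μ} (hY : IsSmooth Y) (hZ : IsSmooth Z) : IsSmooth (Y - Z) :=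
  ContMDiff.sub_section hY hZ

/-- Every tangent vector extends to a smooth vector field. -/
lemma exists_isSmooth_val_eq [T2Space (ReducedSpace A μ)] (y : ReducedSpace A μ)
    (v : EuclideanSpace ℝ (Fin (2 * n))) : ∃ Y : VField A μ, IsSmooth Y ∧ Y.val y = v := by
  let v' : TangentSpace (𝓡 (2 * n)) y := v
  obtain ⟨s, hs, hsm⟩ := FiberBundle.exists_contMDiffOn_extend (k := ∞) (𝓡 (2 * n))
    (EuclideanSpace ℝ (Fin (2 * n))) v'
  -- A bump function supported where the local extension is smooth makes it global.
  obtain ⟨f, hf, -⟩ := (SmoothBumpFunction.nhds_basis_support (I := 𝓡 (2 * n))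
    (interior_mem_nhds.2 hs)).mem_iff.1 Filter.univ_mem
  let σ : VField A μ := FiberBundle.extend (EuclideanSpace ℝ (Fin (2 * n))) v'
  refine ⟨(f : ReducedSpace A μ → ℝ) • σ, ContMDiffOn.smul_section_of_tsupport
    f.contMDiff.contMDiffOn isOpen_interior hf (hsm.mono interior_subset), ?_⟩
  change f y • σ y = v
  rw [f.eq_one, one_smul]
  exact FiberBundle.extend_apply_self _ v'

end Charts

/-! ### Smoothness of lifts, brackets, and descent of smooth fields. -/

section ChartProjection

variable {n : ℕ} {A : Mat n} {μ : ℝ} [Nonempty (quadric A μ)]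
  [ChartedSpace (EuclideanSpace ℝ (Fin (2 * n))) (ReducedSpace A μ)]

variable (A μ) in
/-- The projection in the preferred chart at `y₀`. -/
noncomputable def chartProj (y₀ : ReducedSpace A μ) (x : Vec n) : EuclideanSpace ℝ (Fin (2 * n)) :=
  extChartAt (𝓡 (2 * n)) y₀ (coneProj A μ x)

lemma eventually_mem_source (hμ : μ ≠ 0) (hπ : IsSmoothSubmersion A μ) {x : Vec n}
    (hx : x ∈ cone A μ) {y₀ : ReducedSpace A μ} (hy : coneProj A μ x = y₀) :
    ∀ᶠ x' in 𝓝 x, x' ∈ cone A μ ∧ coneProj A μ x' ∈ (extChartAt (𝓡 (2 * n)) y₀).source := by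
  have h1 : ContinuousAt (coneProj A μ) x := (contMDiffAt_coneProj hμ hπ hx).continuousAt
  have h2 := h1.preimage_mem_nhds (t := (extChartAt (𝓡 (2 * n)) y₀).source)
    (by rw [hy]; exact extChartAt_source_mem_nhds (I := 𝓡 (2 * n)) y₀)
  filter_upwards [h2, isOpen_cone.mem_nhds hx] with x' h3 h4 using ⟨h4, h3⟩

/-- The extension of the lift of a vector field to the cone over the quadric. -/
noncomputable def coneLift (Y : VField A μ) (x : Vec n) : Vec n := lift Y (retr A μ x)

lemma coneLift_of_mem (hμ : μ ≠ 0) (Y : VField A μ) {x : Vec n} (hx : x ∈ quadric A μ) :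
    coneLift Y x = lift Y x := by
  rw [coneLift, retr_of_mem hμ hx]

variable [IsManifold (𝓡 (2 * n)) ∞ (ReducedSpace A μ)]

lemma fderiv_chartProj (hμ : μ ≠ 0) (hπ : IsSmoothSubmersion A μ) {x : Vec n} (hx : x ∈ cone A μ)
    {y₀ : ReducedSpace A μ} (hy : coneProj A μ x ∈ (extChartAt (𝓡 (2 * n)) y₀).source) :
    fderiv ℝ (chartProj A μ y₀) x = (dchart y₀ (coneProj A μ x)).comp (dcone A μ x) := by
  have h : HasMFDerivAt 𝓘(ℝ, Vec n) 𝓘(ℝ, EuclideanSpace ℝ (Fin (2 * n))) (chartProj A μ y₀) x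
      ((dchart y₀ (coneProj A μ x)).comp (dcone A μ x)) :=
    (hasMFDerivAt_extChart hy).comp x (hasMFDerivAt_coneProj hμ hπ hx)
  have h2 : HasFDerivAt (chartProj A μ y₀) ((dchart y₀ (coneProj A μ x)).comp (dcone A μ x)) x :=
    hasMFDerivAt_iff_hasFDerivAt.1 h
  exact h2.fderiv

lemma contDiffAt_chartProj (hμ : μ ≠ 0) (hπ : IsSmoothSubmersion A μ) {x : Vec n}
    (hx : x ∈ cone A μ) {y₀ : ReducedSpace A μ}
    (hy : coneProj A μ x ∈ (extChartAt (𝓡 (2 * n)) y₀).source) :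
    ContDiffAt ℝ ∞ (chartProj A μ y₀) x := by
  have h : ContMDiffAt 𝓘(ℝ, Vec n) 𝓘(ℝ, EuclideanSpace ℝ (Fin (2 * n))) ∞ (chartProj A μ y₀) x :=
    (contMDiffAt_extChartAt' (by rwa [extChartAt_source] at hy)).comp x
      (contMDiffAt_coneProj hμ hπ hx)
  exact contMDiffAt_iff_contDiffAt.1 h

/-- The vector v need not be horizontal, which allows arbitrary smooth fields that project to Y. -/
lemma fderiv_chartProj_lift (hμ : μ ≠ 0) (hπ : IsSmoothSubmersion A μ) (Y : VField A μ)
    {x : Vec n} (hx : x ∈ quadric A μ) {y₀ : ReducedSpace A μ}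
    (hy : coneProj A μ x ∈ (extChartAt (𝓡 (2 * n)) y₀).source) {v : Vec n}
    (hv : dcone A μ x v = Y.val (proj A μ x)) :
    fderiv ℝ (chartProj A μ y₀) x v = chartField y₀ Y (chartProj A μ y₀ x) := by
  rw [fderiv_chartProj hμ hπ (quadric_subset_cone hμ hx) hy, chartProj, chartField_apply hy,
    ContinuousLinearMap.comp_apply, hv, coneProj_of_mem hμ hx]

/-- Locally, the lift of a smooth vector field is the restriction of a smooth map. -/
lemma exists_contDiffAt_eq_lift (hA : A ∈ LieAlgebra.Symplectic.sp (Fin (n + 1)) ℝ) (hμ : μ ≠ 0)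
    (hπ : IsSmoothSubmersion A μ) {Y : VField A μ} (hY : IsSmooth Y) {x₀ : Vec n}
    (hx₀ : x₀ ∈ quadric A μ) :
    ∃ g : Vec n → Vec n, ContDiffAt ℝ ∞ g x₀ ∧ ∀ᶠ x in 𝓝 x₀, x ∈ quadric A μ → lift Y x = g x := by
  set y₀ := coneProj A μ x₀ with hy₀
  have hc := quadric_subset_cone hμ hx₀
  have hev := eventually_mem_source hμ hπ hc hy₀.symm
  -- `frameMap` with dπ read in a fixed chart, so that it depends smoothly on x as a map between
  -- fixed spaces; the lift solves K v = (Y in the chart, 0, 0).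
  let K : Vec n → Vec n →L[ℝ] EuclideanSpace ℝ (Fin (2 * n)) × ℝ × ℝ := fun x =>
    (fderiv ℝ (chartProj A μ y₀) x).prod (((omegaL n).flip x).prod ((omegaL n).flip (actL A x)))
  have hF := contDiffAt_chartProj hμ hπ hc hev.self_of_nhds.2
  have hK : ContDiffAt ℝ ∞ K x₀ := by
    have h1 : ContDiffAt ℝ ∞ (fun x => ((omegaL n).flip x, (omegaL n).flip (actL A x))) x₀ :=
      ((omegaL n).flip.contDiff.prodMk ((omegaL n).flip.contDiff.comp
        (actL A).contDiff)).contDiffAt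
    have h2 := (ContinuousLinearMap.prodₗᵢ ℝ (𝕜 := ℝ) (E := Vec n) (F := ℝ)
      (G := ℝ)).toContinuousLinearEquiv.contDiff.contDiffAt.comp x₀ h1
    exact (ContinuousLinearMap.prodₗᵢ ℝ (𝕜 := ℝ) (E := Vec n) (F := EuclideanSpace ℝ (Fin (2 * n)))
      (G := ℝ × ℝ)).toContinuousLinearEquiv.contDiff.contDiffAt.comp x₀
      ((hF.fderiv_right (m := ∞) (by simp)).prodMk h2)
  have hinv : ∀ᶠ x in 𝓝 x₀, x ∈ quadric A μ → (K x).IsInvertible := by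
    filter_upwards [hev] with x hx hxq
    obtain ⟨e, he⟩ := isInvertible_dchart hx.2
    have h1 : Function.Bijective (K x) := by
      have h2 : (K x : Vec n → _) = Prod.map e id ∘ frameMap A μ x := by
        ext1 v
        change (fderiv ℝ (chartProj A μ y₀) x v, _, _) = _
        rw [fderiv_chartProj hμ hπ hx.1 hx.2, ← he]
        rfl
      rw [h2]
      exact (e.bijective.prodMap Function.bijective_id).comp (bijective_frameMap hA hμ hπ hxq)
    exact ⟨ContinuousLinearEquiv.ofBijective (K x) (LinearMap.ker_eq_bot.2 h1.1)
      (LinearMap.range_eq_top.2 h1.2), rfl⟩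
  refine ⟨fun x => (K x).inverse (chartField y₀ Y (chartProj A μ y₀ x), 0, 0), ?_, ?_⟩
  · have h1 := (hinv.self_of_nhds hx₀).contDiffAt_map_inverse (n := ∞)
    have h2 : ContDiffAt ℝ ∞ (fun x => chartField y₀ Y (chartProj A μ y₀ x)) x₀ :=
      ContDiffAt.comp x₀ (contDiffAt_chartField hY y₀) hF
    exact (h1.comp x₀ hK).clm_apply (h2.prodMk contDiffAt_const)
  · filter_upwards [hinv, hev] with x hx hxs hxq
    obtain ⟨h1, h2⟩ := lift_spec hA hμ hπ Y hxq
    have h3 : K x (lift Y x) = (chartField y₀ Y (chartProj A μ y₀ x), 0, 0) := by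
      change (fderiv ℝ (chartProj A μ y₀) x _, omegaL n _ _, omegaL n _ _) = _
      rw [fderiv_chartProj_lift hμ hπ Y hxq hxs.2 h2]
      rw [mem_horizontal_iff] at h1
      rw [h1.1, h1.2]
    obtain ⟨e, he⟩ := hx hxq
    rw [← h3, ← he, ContinuousLinearMap.inverse_equiv]
    simp

lemma contDiffAt_coneLift (hA : A ∈ LieAlgebra.Symplectic.sp (Fin (n + 1)) ℝ) (hμ : μ ≠ 0)
    (hπ : IsSmoothSubmersion A μ) {Y : VField A μ} (hY : IsSmooth Y) {x : Vec n}
    (hx : x ∈ cone A μ) : ContDiffAt ℝ ∞ (coneLift Y) x := by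
  obtain ⟨g, hg, h⟩ := exists_contDiffAt_eq_lift hA hμ hπ hY (retr_mem hx)
  have hr := contDiffAt_retr hμ hx
  refine (hg.comp x hr).congr_of_eventuallyEq ?_
  filter_upwards [hr.continuousAt.eventually h, isOpen_cone.mem_nhds hx] with x' h1 h2
  exact h1 (retr_mem h2)

/-- The lift of the Lie bracket is the horizontal part of the bracket of the lifts. -/
lemma dcone_bracket (hA : A ∈ LieAlgebra.Symplectic.sp (Fin (n + 1)) ℝ) (hμ : μ ≠ 0)
    (hπ : IsSmoothSubmersion A μ) {Y Z : VField A μ} (hY : IsSmooth Y) (hZ : IsSmooth Z)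
    {x : Vec n} (hx : x ∈ quadric A μ) :
    dcone A μ x (fderiv ℝ (coneLift Z) x (lift Y x) - fderiv ℝ (coneLift Y) x (lift Z x))
      = VField.val (VectorField.mlieBracket (𝓡 (2 * n)) Y Z) (proj A μ x) := by
  set y₀ := coneProj A μ x with hy₀
  have hc := quadric_subset_cone hμ hx
  have hev := eventually_mem_source hμ hπ hc hy₀.symm
  have hs : coneProj A μ x ∈ (extChartAt (𝓡 (2 * n)) y₀).source := hev.self_of_nhds.2
  have hF := contDiffAt_chartProj hμ hπ hc hs
  have hF' : DifferentiableAt ℝ (fderiv ℝ (chartProj A μ y₀)) x :=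
    (hF.fderiv_right (m := ∞) (by simp)).differentiableAt (by simp)
  -- With F the projection in the chart, differentiate DF(Ȳ) = Y ∘ F along Z̄. The identity holds
  -- only on Σ, but Z̄ is tangent to Σ. Antisymmetrizing in Y and Z removes D²F.
  have key : ∀ {Y Z : VField A μ}, IsSmooth Y → IsSmooth Z →
      fderiv ℝ (fderiv ℝ (chartProj A μ y₀)) x (lift Z x) (lift Y x)
        + fderiv ℝ (chartProj A μ y₀) x (fderiv ℝ (coneLift Y) x (lift Z x))
      = fderiv ℝ (chartField y₀ Y) (chartProj A μ y₀ x) (chartField y₀ Z (chartProj A μ y₀ x)) := by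
    intro Y Z hY hZ
    have hYd := (contDiffAt_coneLift hA hμ hπ hY hc).differentiableAt (by simp)
    have hcd : DifferentiableAt ℝ (chartField y₀ Y) (chartProj A μ y₀ x) :=
      (contDiffAt_chartField hY y₀).differentiableAt (by simp)
    have hFd := hF.differentiableAt (by simp)
    have h1 := fderiv_eq_of_eqOn hA hμ (v := lift Z x)
      (f := fun x' => fderiv ℝ (chartProj A μ y₀) x' (coneLift Y x'))
      (g := fun x' => chartField y₀ Y (chartProj A μ y₀ x')) hx (hF'.clm_apply hYd)
      (hcd.comp x hFd) ⟨_, hev, fun x' hx' => by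
        have h2 := (lift_spec hA hμ hπ Y hx'.1).2
        rw [← coneLift_of_mem hμ Y hx'.1] at h2
        exact fderiv_chartProj_lift hμ hπ Y hx'.1 hx'.2.2 h2⟩ (lift_spec hA hμ hπ Z hx).1.2
    rw [fderiv_clm_apply hF' hYd] at h1
    have h3 : fderiv ℝ (fun x' => chartField y₀ Y (chartProj A μ y₀ x')) x
        = (fderiv ℝ (chartField y₀ Y) (chartProj A μ y₀ x)).comp
          (fderiv ℝ (chartProj A μ y₀) x) := fderiv_comp x hcd hFd
    rw [h3, ContinuousLinearMap.comp_apply,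
      fderiv_chartProj_lift hμ hπ Z hx hs (lift_spec hA hμ hπ Z hx).2] at h1
    rw [← h1]
    simp [coneLift_of_mem hμ Y hx, add_comm]
  have hsymm := hF.isSymmSndFDerivAt
    (by simp; exact WithTop.coe_le_coe.2 (le_top : (2 : ℕ∞) ≤ ⊤)) (lift Y x) (lift Z x)
  have h1 := key hZ hY
  have h2 := key hY hZ
  have h3 : fderiv ℝ (chartProj A μ y₀) x
      (fderiv ℝ (coneLift Z) x (lift Y x) - fderiv ℝ (coneLift Y) x (lift Z x))
      = VectorField.lieBracket ℝ (chartField y₀ Y) (chartField y₀ Z) (chartProj A μ y₀ x) := by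
    rw [map_sub, VectorField.lieBracket, ← h1, ← h2, hsymm]
    abel
  rw [fderiv_chartProj hμ hπ hc hs, ← hy₀, dchart_self, ContinuousLinearMap.id_comp] at h3
  rw [h3, ← coneProj_of_mem hμ hx, ← hy₀]
  have h4 : VField.val (VectorField.mlieBracket (𝓡 (2 * n)) Y Z) y₀ = (dchart y₀ y₀).inverse
      (VectorField.lieBracketWithin ℝ (chartField y₀ Y) (chartField y₀ Z)
        ((extChartAt (𝓡 (2 * n)) y₀).symm ⁻¹' Set.univ ∩ Set.range (𝓡 (2 * n)))
        (chartProj A μ y₀ x)) := rfl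
  rw [h4, dchart_self, ContinuousLinearMap.inverse_id]
  simp

/-- A vector field on `M` having a smooth lift is smooth. -/
lemma isSmooth_of_dcone (hA : A ∈ LieAlgebra.Symplectic.sp (Fin (n + 1)) ℝ) (hμ : μ ≠ 0)
    (hπ : IsSmoothSubmersion A μ) {W : VField A μ} {G : Vec n → Vec n}
    (hG : ∀ x ∈ quadric A μ, ContDiffAt ℝ ∞ G x)
    (hW : ∀ x ∈ quadric A μ, dcone A μ x (G x) = W.val (proj A μ x)) : IsSmooth W := by
  refine isSmooth_of_chartField fun y₀ => ?_
  obtain ⟨x₀, hx₀, hxy⟩ := exists_proj_eq y₀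
  rw [← coneProj_of_mem hμ hx₀] at hxy
  have hc := quadric_subset_cone hμ hx₀
  have hev := eventually_mem_source hμ hπ hc hxy
  have hF := contDiffAt_chartProj hμ hπ hc hev.self_of_nhds.2
  -- A right inverse of dπ gives an affine slice through x₀ on which π in the chart has identity
  -- derivative; the inverse function theorem then yields a local section.
  obtain ⟨j, hj⟩ := ContinuousLinearMap.exists_rightInverse_of_surjective (dcone A μ x₀)
    (LinearMap.range_eq_top.2 (dcone_surjective hA hμ hπ hx₀))
  let E := EuclideanSpace ℝ (Fin (2 * n))
  let ℓ : E → Vec n := fun e => x₀ + j e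
  have hℓ : ContDiff ℝ ∞ ℓ := contDiff_const.add j.contDiff
  have hℓ0 : ℓ 0 = x₀ := by simp [ℓ]
  let k : E → E := fun e => chartProj A μ y₀ (ℓ e)
  have hk : ContDiffAt ℝ ∞ k 0 :=
    ContDiffAt.comp (0 : E) (g := chartProj A μ y₀) (f := ℓ) (by rw [hℓ0]; exact hF) hℓ.contDiffAt
  have hk0 : k 0 = extChartAt (𝓡 (2 * n)) y₀ y₀ := by
    simp only [k, hℓ0, chartProj, hxy]
  have hk' : HasFDerivAt k ((ContinuousLinearEquiv.refl ℝ E : E ≃L[ℝ] E) : E →L[ℝ] E) 0 := by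
    have h1 : HasFDerivAt (chartProj A μ y₀) (fderiv ℝ (chartProj A μ y₀) x₀) (ℓ 0) := by
      rw [hℓ0]; exact (hF.differentiableAt (by simp)).hasFDerivAt
    have h2 := h1.comp (0 : E) (j.hasFDerivAt.const_add x₀)
    rw [fderiv_chartProj hμ hπ hc hev.self_of_nhds.2, hxy, dchart_self,
      ContinuousLinearMap.id_comp, hj] at h2
    exact h2
  let κ := hk.localInverse hk' (by simp)
  have hκ : ContDiffAt ℝ ∞ κ (k 0) := hk.to_localInverse hk' (by simp)
  have hκ0 : κ (k 0) = 0 := hk.localInverse_apply_image hk' (by simp)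
  have hinv : ∀ᶠ e in 𝓝 (k 0), k (κ e) = e :=
    (hk.hasStrictFDerivAt' hk' (by simp)).eventually_right_inverse
  -- The section is retracted onto Σ, where G is known to project to W; this leaves its image in M
  -- unchanged.
  have hs : ContDiffAt ℝ ∞ (fun e => retr A μ (ℓ (κ e))) (k 0) := by
    refine ContDiffAt.comp (k 0) (g := retr A μ) ?_ (hℓ.contDiffAt.comp (k 0) hκ)
    simp only [hκ0, hℓ0]
    exact contDiffAt_retr hμ hc
  have hs0 : retr A μ (ℓ (κ (k 0))) = x₀ := by rw [hκ0, hℓ0, retr_of_mem hμ hx₀]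
  rw [← hk0]
  have hmain : ContDiffAt ℝ ∞ (fun e => fderiv ℝ (chartProj A μ y₀) (retr A μ (ℓ (κ e)))
      (G (retr A μ (ℓ (κ e))))) (k 0) := by
    have h1 : ContDiffAt ℝ ∞ (fun x => fderiv ℝ (chartProj A μ y₀) x (G x)) x₀ :=
      (hF.fderiv_right (m := ∞) (by simp)).clm_apply (hG x₀ hx₀)
    exact ContDiffAt.comp (k 0) (by rw [hs0]; exact h1) hs
  refine hmain.congr_of_eventuallyEq ?_
  have hev2 : ∀ᶠ e in 𝓝 (k 0), ℓ (κ e) ∈ cone A μ ∧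
      coneProj A μ (ℓ (κ e)) ∈ (extChartAt (𝓡 (2 * n)) y₀).source := by
    have : Filter.Tendsto (fun e => ℓ (κ e)) (𝓝 (k 0)) (𝓝 x₀) := by
      have h := (hℓ.contDiffAt.comp (k 0) hκ).continuousAt.tendsto
      rw [Function.comp_apply, hκ0, hℓ0] at h
      exact h
    exact this.eventually hev
  filter_upwards [hinv, hev2] with e h1 h2
  have hq := retr_mem h2.1
  have h3 : coneProj A μ (retr A μ (ℓ (κ e))) = coneProj A μ (ℓ (κ e)) :=
    coneProj_of_mem hμ hq
  rw [fderiv_chartProj_lift hμ hπ W hq (by rw [h3]; exact h2.2) (hW _ hq), chartProj, h3]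
  exact congrArg _ h1.symm

end ChartProjection

/-! ### The reduced connection, its curvature and the derivative of the curvature. -/

section Connection

variable {n : ℕ} {A : Mat n} {μ : ℝ} [Nonempty (quadric A μ)]
  [ChartedSpace (EuclideanSpace ℝ (Fin (2 * n))) (ReducedSpace A μ)]

lemma coneLift_flowL (hA : A ∈ LieAlgebra.Symplectic.sp (Fin (n + 1)) ℝ) (hμ : μ ≠ 0)
    (hπ : IsSmoothSubmersion A μ) (Y : VField A μ) (t : ℝ) {x : Vec n} (hx : x ∈ cone A μ) :
    coneLift Y (flowL A t x) = flowL A t (coneLift Y x) := by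
  rw [coneLift, retr_flowL hA, lift_flowL hA hμ hπ Y t (retr_mem hx), coneLift]

lemma coneLift_horizontal (hA : A ∈ LieAlgebra.Symplectic.sp (Fin (n + 1)) ℝ) (hμ : μ ≠ 0)
    (hπ : IsSmoothSubmersion A μ) (Y : VField A μ) {x : Vec n} (hx : x ∈ quadric A μ) :
    omegaL n (coneLift Y x) x = 0 ∧ omegaL n (coneLift Y x) (actL A x) = 0 := by
  rw [coneLift_of_mem hμ Y hx]
  exact (lift_spec hA hμ hπ Y hx).1

variable [IsManifold (𝓡 (2 * n)) ∞ (ReducedSpace A μ)]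

lemma fderiv_coneLift_flowL (hA : A ∈ LieAlgebra.Symplectic.sp (Fin (n + 1)) ℝ) (hμ : μ ≠ 0)
    (hπ : IsSmoothSubmersion A μ) {Y : VField A μ} (hY : IsSmooth Y) (t : ℝ) {x : Vec n}
    (hx : x ∈ cone A μ) (v : Vec n) :
    fderiv ℝ (coneLift Y) (flowL A t x) (flowL A t v) = flowL A t (fderiv ℝ (coneLift Y) x v) := by
  have h1 : coneLift Y ∘ flowL A t =ᶠ[𝓝 x] flowL A t ∘ coneLift Y := by
    filter_upwards [isOpen_cone.mem_nhds hx] with y hy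
    exact coneLift_flowL hA hμ hπ Y t hy
  have h2 := h1.fderiv_eq (𝕜 := ℝ)
  rw [fderiv_comp x ((contDiffAt_coneLift hA hμ hπ hY (flowL_mem_cone hA t hx)).differentiableAt
    (by simp)) (flowL A t).differentiableAt, fderiv_comp x (flowL A t).differentiableAt
    ((contDiffAt_coneLift hA hμ hπ hY hx).differentiableAt (by simp)),
    ContinuousLinearMap.fderiv, ContinuousLinearMap.fderiv] at h2
  exact congrArg (fun L => L v) h2

/-- Differentiating the equivariance of the lift along the flow at t = 0. -/
lemma fderiv_coneLift_actL (hA : A ∈ LieAlgebra.Symplectic.sp (Fin (n + 1)) ℝ) (hμ : μ ≠ 0)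
    (hπ : IsSmoothSubmersion A μ) {Y : VField A μ} (hY : IsSmooth Y) {x : Vec n}
    (hx : x ∈ cone A μ) : fderiv ℝ (coneLift Y) x (actL A x) = actL A (coneLift Y x) := by
  have h1 := hasDerivAt_flowL (A := A) 0 x
  have h2 := hasDerivAt_flowL (A := A) 0 (coneLift Y x)
  rw [flowL_zero] at h1 h2
  have h3 : HasFDerivAt (coneLift Y) (fderiv ℝ (coneLift Y) x) (flowL A 0 x) := by
    rw [flowL_zero]
    exact ((contDiffAt_coneLift hA hμ hπ hY hx).differentiableAt (by simp)).hasFDerivAt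
  have h4 := h3.comp_hasDerivAt (0 : ℝ) h1
  have h5 : coneLift Y ∘ (fun t => flowL A t x) = fun t => flowL A t (coneLift Y x) :=
    funext fun t => coneLift_flowL hA hμ hπ Y t hx
  rw [h5] at h4
  have h6 := h4.unique h2
  rw [map_smul] at h6
  exact smul_right_injective _ (by norm_num : (-2 : ℝ) ≠ 0) h6

/-- Differentiating ω(Z̄, x) = 0 and ω(Z̄, Ax) = 0 along X leaves ω(Z̄, X) and ω(Z̄, AX), exactly
what the corrections along Ax and x compensate. -/
lemma liftConn_horizontal (hA : A ∈ LieAlgebra.Symplectic.sp (Fin (n + 1)) ℝ) (hμ : μ ≠ 0)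
    (hπ : IsSmoothSubmersion A μ) {Z : VField A μ} (hZ : IsSmooth Z) {x : Vec n}
    (hx : x ∈ quadric A μ) {X : Vec n} (hX : X ∈ horizontal A x) :
    liftConn (omegaL n) (actL A) μ X (coneLift Z) x ∈ horizontal A x := by
  have hZd := (contDiffAt_coneLift hA hμ hπ hZ (quadric_subset_cone hμ hx)).differentiableAt
    (by simp)
  obtain ⟨h1, h2⟩ := coneLift_horizontal hA hμ hπ Z hx
  have h3 := fderiv_eq_of_eqOn hA hμ (f := fun y => omegaL n (coneLift Z y) (id y))
    (g := fun _ => (0 : ℝ)) hx (differentiableAt_bilin hZd differentiableAt_id)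
    (differentiableAt_const _) ⟨Set.univ, Filter.univ_mem,
      fun y hy => (coneLift_horizontal hA hμ hπ Z hy.1).1⟩ hX.2
  have h4 := fderiv_eq_of_eqOn hA hμ (f := fun y => omegaL n (coneLift Z y) (actL A y))
    (g := fun _ => (0 : ℝ)) hx (differentiableAt_bilin hZd (actL A).differentiableAt)
    (differentiableAt_const _) ⟨Set.univ, Filter.univ_mem,
      fun y hy => (coneLift_horizontal hA hμ hπ Z hy.1).2⟩ hX.2
  rw [fderiv_bilin hZd differentiableAt_id] at h3
  rw [fderiv_bilin hZd (actL A).differentiableAt, ContinuousLinearMap.fderiv] at h4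
  simp only [fderiv_id, ContinuousLinearMap.id_apply, id, fderiv_fun_const, Pi.zero_apply,
    zero_apply] at h3 h4
  have e1 := mem_quadric_iff.1 hx
  have e2 := omegaL_actL_self hx
  have e3 := omegaL_antisymm X (coneLift Z x)
  rw [mem_horizontal_iff, liftConn]
  simp only [map_add, map_smul, add_apply, smul_apply, smul_eq_mul, omegaL_self, e1, e2]
  constructor
  · field_simp
    linear_combination μ * h3 - μ * e3
  · field_simp
    linear_combination μ * h4

/-- The defining formula of the reduced connection in terms of the extended lifts. -/
lemma isReducedDeriv_iff (hA : A ∈ LieAlgebra.Symplectic.sp (Fin (n + 1)) ℝ) (hμ : μ ≠ 0)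
    (hπ : IsSmoothSubmersion A μ) {Y Z : VField A μ} (hZ : IsSmooth Z) (W : VField A μ) :
    IsReducedDeriv Y Z W ↔ ∀ x ∈ quadric A μ,
      lift W x = liftConn (omegaL n) (actL A) μ (lift Y x) (coneLift Z) x := by
  refine forall₂_congr fun x hx => ?_
  have h1 := fderivWithin_quadric hA hμ hx
    ((contDiffAt_coneLift hA hμ hπ hZ (quadric_subset_cone hμ hx)).differentiableAt (by simp))
    (fun y hy => (coneLift_of_mem hμ Z hy).symm) (lift_spec hA hμ hπ Y hx).1.2
  rw [quadricConn, flatDeriv, h1, liftConn, coneLift_of_mem hμ Z hx]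
  rfl

lemma liftConn_flowL (hA : A ∈ LieAlgebra.Symplectic.sp (Fin (n + 1)) ℝ) (hμ : μ ≠ 0)
    (hπ : IsSmoothSubmersion A μ) {Z : VField A μ} (hZ : IsSmooth Z) (t : ℝ) {x : Vec n}
    (hx : x ∈ quadric A μ) (X : Vec n) :
    liftConn (omegaL n) (actL A) μ (flowL A t X) (coneLift Z) (flowL A t x)
      = flowL A t (liftConn (omegaL n) (actL A) μ X (coneLift Z) x) := by
  have hc := quadric_subset_cone hμ hx
  rw [liftConn, liftConn, coneLift_flowL hA hμ hπ Z t hc, fderiv_coneLift_flowL hA hμ hπ hZ t hc,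
    ← flowL_actL, ← flowL_actL, omegaL_flowL hA, omegaL_flowL hA]
  simp only [map_add, map_smul]

/-- Project the formula at one chosen point of each orbit; equivariance under the flow makes the
result correct along the whole orbit. -/
lemma exists_isReducedDeriv (hA : A ∈ LieAlgebra.Symplectic.sp (Fin (n + 1)) ℝ) (hμ : μ ≠ 0)
    (hπ : IsSmoothSubmersion A μ) (Y : VField A μ) {Z : VField A μ} (hZ : IsSmooth Z) :
    ∃ W : VField A μ, IsReducedDeriv Y Z W := by
  choose s hs hsp using exists_proj_eq (A := A) (μ := μ)
  let G : Vec n → Vec n := fun x => liftConn (omegaL n) (actL A) μ (lift Y x) (coneLift Z) x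
  let W : VField A μ := fun y => dcone A μ (s y) (G (s y))
  refine ⟨W, (isReducedDeriv_iff hA hμ hπ hZ W).2 fun x hx => ?_⟩
  refine lift_eq hA hμ hπ W hx (liftConn_horizontal hA hμ hπ hZ hx (lift_spec hA hμ hπ Y hx).1) ?_
  obtain ⟨t, ht⟩ := (proj_eq_iff hx (hs (proj A μ x))).1 (hsp (proj A μ x)).symm
  have h1 : G (flowL A t x) = flowL A t (G x) := by
    simp only [G]
    rw [lift_flowL hA hμ hπ Y t hx, liftConn_flowL hA hμ hπ hZ t hx]
  change dcone A μ x (G x) = dcone A μ (s (proj A μ x)) (G (s (proj A μ x)))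
  rw [← ht, h1, dcone_flowL hA hμ hπ t (quadric_subset_cone hμ hx)]

lemma isReducedDeriv_reducedConn (hA : A ∈ LieAlgebra.Symplectic.sp (Fin (n + 1)) ℝ) (hμ : μ ≠ 0)
    (hπ : IsSmoothSubmersion A μ) (Y : VField A μ) {Z : VField A μ} (hZ : IsSmooth Z) :
    IsReducedDeriv Y Z (reducedConn A μ Y Z) :=
  Classical.epsilon_spec (exists_isReducedDeriv hA hμ hπ Y hZ)

lemma lift_reducedConn (hA : A ∈ LieAlgebra.Symplectic.sp (Fin (n + 1)) ℝ) (hμ : μ ≠ 0)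
    (hπ : IsSmoothSubmersion A μ) (Y : VField A μ) {Z : VField A μ} (hZ : IsSmooth Z) {x : Vec n}
    (hx : x ∈ quadric A μ) : lift (reducedConn A μ Y Z) x
      = liftConn (omegaL n) (actL A) μ (coneLift Y x) (coneLift Z) x := by
  rw [coneLift_of_mem hμ Y hx]
  exact (isReducedDeriv_iff hA hμ hπ hZ _).1 (isReducedDeriv_reducedConn hA hμ hπ Y hZ) x hx

lemma isSmooth_reducedConn (hA : A ∈ LieAlgebra.Symplectic.sp (Fin (n + 1)) ℝ) (hμ : μ ≠ 0)
    (hπ : IsSmoothSubmersion A μ) {Y Z : VField A μ} (hY : IsSmooth Y) (hZ : IsSmooth Z) :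
    IsSmooth (reducedConn A μ Y Z) := by
  refine isSmooth_of_dcone hA hμ hπ (fun x hx => contDiffAt_liftConn (A := A) (μ := μ)
    (contDiffAt_coneLift hA hμ hπ hY (quadric_subset_cone hμ hx))
    (contDiffAt_coneLift hA hμ hπ hZ (quadric_subset_cone hμ hx))) fun x hx => ?_
  rw [← lift_reducedConn hA hμ hπ Y hZ hx]
  exact (lift_spec hA hμ hπ _ hx).2

/-- The reduced connection is torsion-free: the corrections along x and Ax die under dπ, leaving the
bracket of the lifts. -/
lemma lift_mlieBracket (hA : A ∈ LieAlgebra.Symplectic.sp (Fin (n + 1)) ℝ) (hμ : μ ≠ 0)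
    (hπ : IsSmoothSubmersion A μ) {Y Z : VField A μ} (hY : IsSmooth Y) (hZ : IsSmooth Z)
    {x : Vec n} (hx : x ∈ quadric A μ) :
    lift (VectorField.mlieBracket (𝓡 (2 * n)) Y Z : VField A μ) x
      = liftConn (omegaL n) (actL A) μ (coneLift Y x) (coneLift Z) x
        - liftConn (omegaL n) (actL A) μ (coneLift Z x) (coneLift Y) x := by
  have hc := quadric_subset_cone hμ hx
  refine lift_eq hA hμ hπ _ hx (horizontal_sub
    (liftConn_horizontal hA hμ hπ hZ hx (coneLift_horizontal hA hμ hπ Y hx))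
    (liftConn_horizontal hA hμ hπ hY hx (coneLift_horizontal hA hμ hπ Z hx))) ?_
  rw [← dcone_bracket hA hμ hπ hY hZ hx]
  simp only [liftConn, map_add, map_sub, map_smul, dcone_self hμ hπ hc, dcone_actL hA hμ hπ hc,
    smul_zero, add_zero, coneLift_of_mem hμ _ hx]

lemma isSmooth_curvature (hA : A ∈ LieAlgebra.Symplectic.sp (Fin (n + 1)) ℝ) (hμ : μ ≠ 0)
    (hπ : IsSmoothSubmersion A μ) {Y Z T : VField A μ} (hY : IsSmooth Y) (hZ : IsSmooth Z)
    (hT : IsSmooth T) : IsSmooth (curvature (reducedConn A μ) Y Z T) := by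
  have h := fun {Y Z : VField A μ} => isSmooth_reducedConn hA hμ hπ (Y := Y) (Z := Z)
  exact isSmooth_sub (isSmooth_sub (h hY (h hZ hT)) (h hZ (h hY hT)))
    (h (isSmooth_mlieBracket hY hZ) hT)

lemma lift_curvature (hA : A ∈ LieAlgebra.Symplectic.sp (Fin (n + 1)) ℝ) (hμ : μ ≠ 0)
    (hπ : IsSmoothSubmersion A μ) {Y Z T : VField A μ} (hY : IsSmooth Y) (hZ : IsSmooth Z)
    (hT : IsSmooth T) {x : Vec n} (hx : x ∈ quadric A μ) :
    lift (curvature (reducedConn A μ) Y Z T) x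
      = liftCurv (omegaL n) (actL A) μ x (coneLift Y x) (coneLift Z x) (coneLift T x) := by
  have hc := quadric_subset_cone hμ hx
  have cY := contDiffAt_coneLift hA hμ hπ hY hc
  have cZ := contDiffAt_coneLift hA hμ hπ hZ hc
  have cT := contDiffAt_coneLift hA hμ hπ hT hc
  have hYx := coneLift_horizontal hA hμ hπ Y hx
  have hZx := coneLift_horizontal hA hμ hπ Z hx
  have hTx := coneLift_horizontal hA hμ hπ T hx
  obtain ⟨α, β, h⟩ := exists_liftConn_curvature (σ := omegaL n) (a := actL A) (μ := μ)
    omegaL_antisymm (omegaL_actL hA) cY cZ cT (fderiv_coneLift_actL hA hμ hπ hT hc)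
  refine eq_of_horizontal_of_sub_eq omegaL_self hμ (mem_quadric_iff.1 hx)
    (lift_spec hA hμ hπ _ hx).1 (liftCurv_horizontal hA hμ hx hYx hZx hTx)
    (α := α) (β := β) (Eq.trans ?_ h)
  -- The inner lift agrees with the explicit formula only on Σ, which suffices since the outer
  -- derivative is tangential.
  have key : ∀ {X W : VField A μ}, IsSmooth W →
      lift (reducedConn A μ X (reducedConn A μ W T)) x = liftConn (omegaL n) (actL A) μ
        (coneLift X x) (fun y => liftConn (omegaL n) (actL A) μ (coneLift W y) (coneLift T) y) x := by
    intro X W hW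
    have hWT := isSmooth_reducedConn hA hμ hπ hW hT
    rw [lift_reducedConn hA hμ hπ X hWT hx]
    refine liftConn_congr hA hμ hx
      ((contDiffAt_coneLift hA hμ hπ hWT hc).differentiableAt (by simp))
      ((contDiffAt_liftConn (contDiffAt_coneLift hA hμ hπ hW hc) cT).differentiableAt (by simp))
      (fun y hy => ?_) (coneLift_horizontal hA hμ hπ X hx).2
    rw [coneLift_of_mem hμ _ hy, lift_reducedConn hA hμ hπ W hT hy]
  rw [curvature, lift_sub hA hμ hπ _ _ hx, lift_sub hA hμ hπ _ _ hx, key hZ, key hY,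
    lift_reducedConn hA hμ hπ _ hT hx, coneLift_of_mem hμ
      (VectorField.mlieBracket (𝓡 (2 * n)) Y Z : VField A μ) hx, lift_mlieBracket hA hμ hπ hY hZ hx]

lemma lift_curvatureDeriv (hA : A ∈ LieAlgebra.Symplectic.sp (Fin (n + 1)) ℝ) (hμ : μ ≠ 0)
    (hπ : IsSmoothSubmersion A μ) {X Y Z T : VField A μ} (hX : IsSmooth X) (hY : IsSmooth Y)
    (hZ : IsSmooth Z) (hT : IsSmooth T) {x : Vec n} (hx : x ∈ quadric A μ) :
    lift (curvatureDeriv (reducedConn A μ) X Y Z T) x = liftCurvDeriv (omegaL n) (actL A) μ x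
      (lift X x) (lift Y x) (lift Z x) (lift T x) := by
  have hc := quadric_subset_cone hμ hx
  have dY := (contDiffAt_coneLift hA hμ hπ hY hc).differentiableAt (by simp)
  have dZ := (contDiffAt_coneLift hA hμ hπ hZ hc).differentiableAt (by simp)
  have dT := (contDiffAt_coneLift hA hμ hπ hT hc).differentiableAt (by simp)
  have hXx := coneLift_horizontal hA hμ hπ X hx
  have hR := isSmooth_curvature hA hμ hπ hY hZ hT
  have h := fun {Y Z : VField A μ} => isSmooth_reducedConn hA hμ hπ (Y := Y) (Z := Z)
  have h1 : lift (reducedConn A μ X (curvature (reducedConn A μ) Y Z T)) x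
      = liftConn (omegaL n) (actL A) μ (coneLift X x)
        (fun y => liftCurv (omegaL n) (actL A) μ y (coneLift Y y) (coneLift Z y) (coneLift T y)) x := by
    rw [lift_reducedConn hA hμ hπ X hR hx]
    refine liftConn_congr hA hμ hx
      ((contDiffAt_coneLift hA hμ hπ hR hc).differentiableAt (by simp))
      (differentiableAt_liftCurv dY dZ dT) (fun y hy => ?_) hXx.2
    rw [coneLift_of_mem hμ _ hy, lift_curvature hA hμ hπ hY hZ hT hy]
  rw [curvatureDeriv, lift_sub hA hμ hπ _ _ hx, lift_sub hA hμ hπ _ _ hx,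
    lift_sub hA hμ hπ _ _ hx, h1, lift_curvature hA hμ hπ (h hX hY) hZ hT hx,
    lift_curvature hA hμ hπ hY (h hX hZ) hT hx, lift_curvature hA hμ hπ hY hZ (h hX hT) hx,
    coneLift_of_mem hμ (reducedConn A μ X Y) hx, coneLift_of_mem hμ (reducedConn A μ X Z) hx,
    coneLift_of_mem hμ (reducedConn A μ X T) hx, lift_reducedConn hA hμ hπ X hY hx,
    lift_reducedConn hA hμ hπ X hZ hx, lift_reducedConn hA hμ hπ X hT hx,
    liftConn_liftCurv omegaL_antisymm (omegaL_actL hA) dY dZ dT hXx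
      (coneLift_horizontal hA hμ hπ Y hx) (coneLift_horizontal hA hμ hπ Z hx)
      (coneLift_horizontal hA hμ hπ T hx)]
  simp only [coneLift_of_mem hμ _ hx]

lemma exists_isSmooth_lift_eq [T2Space (ReducedSpace A μ)]
    (hA : A ∈ LieAlgebra.Symplectic.sp (Fin (n + 1)) ℝ) (hμ : μ ≠ 0)
    (hπ : IsSmoothSubmersion A μ) {x v : Vec n} (hx : x ∈ quadric A μ) (hv : v ∈ horizontal A x) :
    ∃ Y : VField A μ, IsSmooth Y ∧ lift Y x = v := by
  obtain ⟨Y, hY, h⟩ := exists_isSmooth_val_eq (proj A μ x) (dcone A μ x v)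
  exact ⟨Y, hY, lift_eq hA hμ hπ Y hx hv h.symm⟩

end Connection

/-! ### From the vanishing of the horizontal part of A²x to A² scalar. -/

section Main

/-- An endomorphism for which every vector of a non-empty open set is an eigenvector is a
homothety. -/
lemma exists_eq_smul_of_isOpen {V : Type*} [NormedAddCommGroup V] [NormedSpace ℝ V]
    {B : V →ₗ[ℝ] V} {U : Set V} (hU : IsOpen U) {x : V} (hx : x ∈ U)
    (hx0 : x ≠ 0) (h : ∀ y ∈ U, ∃ c : ℝ, B y = c • y) : ∃ c : ℝ, ∀ v, B v = c • v := by
  obtain ⟨c, hc⟩ := h x hx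
  refine ⟨c, fun v => ?_⟩
  by_cases hv : v ∈ Submodule.span ℝ {x}
  · obtain ⟨s, rfl⟩ := Submodule.mem_span_singleton.1 hv
    rw [map_smul, hc, smul_comm]
  have hev : ∀ᶠ t : ℝ in 𝓝 0, x + t • v ∈ U := by
    have h1 : Continuous fun t : ℝ => x + t • v := by fun_prop
    exact h1.continuousAt.preimage_mem_nhds (hU.mem_nhds (by simpa using hx))
  obtain ⟨ε, hε, hball⟩ := Metric.eventually_nhds_iff.1 hev
  -- Here d is the eigenvalue at x + tv. Two values of t suffice: independence of x and v gives the
  -- same d for both, and then equality of the two quotients (d - c)/t forces d = c.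
  have key : ∀ t : ℝ, 0 < t → t < ε → ∃ d : ℝ, B v = d • v + ((d - c) / t) • x := by
    intro t ht htε
    obtain ⟨d, hd⟩ := h _ (hball (y := t) (by simpa [abs_of_pos ht] using htε))
    refine ⟨d, ?_⟩
    rw [map_add, map_smul, hc] at hd
    have h1 : t • B v = t • (d • v + ((d - c) / t) • x) := by
      have : t • B v = d • (x + t • v) - c • x := by rw [← hd]; abel
      rw [this, smul_add t, smul_smul t, smul_smul t, mul_div_cancel₀ _ ht.ne']
      module
    exact smul_right_injective _ ht.ne' h1
  obtain ⟨d, hd⟩ := key (ε / 2) (by linarith) (by linarith)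
  obtain ⟨d', hd'⟩ := key (ε / 4) (by linarith) (by linarith)
  have hdd : d = d' := by
    by_contra hne
    apply hv
    have h1 : (d - d') • v = ((d' - c) / (ε / 4) - (d - c) / (ε / 2)) • x := by
      have : d • v + ((d - c) / (ε / 2)) • x = d' • v + ((d' - c) / (ε / 4)) • x := by
        rw [← hd, hd']
      rw [sub_smul, sub_smul, sub_eq_sub_iff_add_eq_add, this]
      abel
    rw [← inv_smul_smul₀ (sub_ne_zero.2 hne) v, h1]
    exact Submodule.smul_mem _ _ (Submodule.smul_mem _ _ (Submodule.mem_span_singleton_self x))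
  subst hdd
  have h2 : ((d - c) / (ε / 2)) • x = ((d - c) / (ε / 4)) • x := by
    have := hd.symm.trans hd'
    exact add_left_cancel this
  have h3 := smul_left_injective ℝ hx0 h2
  have h4 : d = c := by
    have h5 : (d - c) / (ε / 2) = (d - c) / (ε / 4) := h3
    field_simp at h5
    linarith
  rw [hd, h4]
  simp

variable {n : ℕ} {A : Mat n} {μ : ℝ}

/-- Skewness gives ω(A²x, x) = -ω(Ax, Ax) = 0, so A²x has no component along Ax and removing the one
along x is enough. -/
lemma redVec_horizontal (hA : A ∈ LieAlgebra.Symplectic.sp (Fin (n + 1)) ℝ) (hμ : μ ≠ 0)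
    {x : Vec n} (hx : x ∈ quadric A μ) :
    redVec (omegaL n) (actL A) μ x ∈ horizontal A x := by
  rw [mem_horizontal_iff, redVec]
  simp only [map_sub, map_smul, sub_apply, smul_apply, smul_eq_mul, omegaL_self,
    mem_quadric_iff.1 hx, omegaL_actL hA (actL A x) x]
  constructor
  · simp
  · field_simp
    ring

/-- Nondegeneracy of ω on H_x: pairing with a horizontal u sees only the horizontal part of a
vector. -/
lemma redVec_eq_zero_of_forall (hμ : μ ≠ 0) {x : Vec n} (hx : x ∈ quadric A μ)
    {u : Vec n} (hu : u ∈ horizontal A x)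
    (h : ∀ v ∈ horizontal A x, omegaL n v u = 0) : u = 0 := by
  refine omegaL_nondegenerate fun w => ?_
  have h1 := h _ (horProj_mem hμ hx w)
  rw [mem_horizontal_iff] at hu
  rw [horProj] at h1
  simpa [omegaL_antisymm x u, omegaL_antisymm (actL A x) u, hu.1, hu.2] using h1

/-- Each point of the cone is a positive multiple of a point of Σ, so all of this open set consists
of eigenvectors of A². -/
lemma sq_eq_smul_one_of_redVec (hμ : μ ≠ 0) [Nonempty (quadric A μ)]
    (h : ∀ x ∈ quadric A μ, redVec (omegaL n) (actL A) μ x = 0) :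
    ∃ c : ℝ, A ^ 2 = c • (1 : Mat n) := by
  obtain ⟨x₀, hx₀⟩ := ‹Nonempty (quadric A μ)›
  have hne : x₀ ≠ 0 := by
    rintro rfl
    exact hμ ((mem_quadric_iff.1 hx₀).symm.trans (by simp))
  obtain ⟨c, hc⟩ := exists_eq_smul_of_isOpen (B := (A ^ 2).mulVecLin) isOpen_cone
    (quadric_subset_cone hμ hx₀) hne fun y hy => by
      have h1 := h _ (retr_mem hy)
      rw [redVec, sub_eq_zero] at h1
      set s := 1 / μ * omegaL n (actL A (actL A (retr A μ y))) (actL A (retr A μ y))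
      have h2 : √(μ / hamiltonian A y) • (A ^ 2).mulVecLin y = √(μ / hamiltonian A y) • s • y := by
        rw [smul_comm _ s y, ← retr, ← h1]
        simp only [retr, map_smul, ← mulVec_eq_actL, Matrix.mulVecLin_apply, pow_two,
          Matrix.mulVec_mulVec]
      exact ⟨s, smul_right_injective _ (Real.sqrt_pos.2 hy).ne' h2⟩
  refine ⟨c, ?_⟩
  ext i j
  have h1 := congrFun (hc (Pi.single j 1)) i
  simpa [Matrix.one_apply, Pi.single_apply] using h1

end Main

end SymplecticReduction

open SymplecticReduction in
theorem mainTheorem2 (n : ℕ) (A : Mat n)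
    (hA : A ∈ LieAlgebra.Symplectic.sp (Fin (n + 1)) ℝ) (hA0 : A ≠ 0)
    (μ : ℝ) (hμ : μ ≠ 0) [Nonempty (quadric A μ)] [T2Space (ReducedSpace A μ)]
    [ChartedSpace (EuclideanSpace ℝ (Fin (2 * n))) (ReducedSpace A μ)]
    [IsManifold (𝓡 (2 * n)) ∞ (ReducedSpace A μ)]
    (hπ : IsSmoothSubmersion A μ) :
    (∀ Y Z : VField A μ, IsSmooth Y → IsSmooth Z →
        IsSmooth (reducedConn A μ Y Z) ∧ IsReducedDeriv Y Z (reducedConn A μ Y Z)) ∧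
      (IsLocallySymmetric (reducedConn A μ) ↔ ∃ c : ℝ, A ^ 2 = c • (1 : Mat n)) := by
  refine ⟨fun Y Z hY hZ => ⟨isSmooth_reducedConn hA hμ hπ hY hZ,
    isReducedDeriv_reducedConn hA hμ hπ Y hZ⟩, fun h => ?_, ?_⟩
  · refine sq_eq_smul_one_of_redVec hμ fun x hx => ?_
    have hu := redVec_horizontal hA hμ hx
    refine redVec_eq_zero_of_forall hμ hx hu fun v hv => ?_
    -- The fields are chosen with lifts u and v at x, then inserted as (∇_U R)(U, T)T, which
    -- isolates the cube of ω(v, u).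
    obtain ⟨U, hU, hUx⟩ := exists_isSmooth_lift_eq hA hμ hπ hx hu
    obtain ⟨T, hT, hTx⟩ := exists_isSmooth_lift_eq hA hμ hπ hx hv
    have h1 := lift_curvatureDeriv hA hμ hπ hU hU hT hT hx
    rw [h U U T T hU hU hT hT, lift_zero hA hμ hπ hx, hUx, hTx] at h1
    exact bilin_redVec_eq_zero omegaL_antisymm hμ h1.symm
  · rintro ⟨c, hc⟩ X Y Z T hX hY hZ hT
    refine eq_of_lift_eq hA hμ hπ fun x hx => ?_
    have h1 : actL A (actL A x) = c • x := by
      rw [← mulVec_eq_actL, ← mulVec_eq_actL, Matrix.mulVec_mulVec, ← pow_two, hc,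
        Matrix.smul_mulVec, Matrix.one_mulVec]
    have h2 : redVec (omegaL n) (actL A) μ x = 0 := by
      rw [redVec, h1, map_smul, smul_apply, mem_quadric_iff.1 hx, smul_eq_mul, mul_left_comm,
        one_div, inv_mul_cancel₀ hμ, mul_one, sub_self]
    rw [lift_curvatureDeriv hA hμ hπ hX hY hZ hT hx, lift_zero hA hμ hπ hx]
    simp [liftCurvDeriv, redEndDeriv, h2]
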